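/- **Setting.** Let $\mathcal S,\mathcal A$ be finite sets, $S=|\mathcal S|$, $A=|\mathcal A|$, and consider an episodic MDP with transition kernel $P^\star$, horizon $H\ge 1$, cost $c:\mathcal S\to[0,1]$ and initial state $s_0$. For a stationary stochastic policy $\pi$ let $V^\pi=\mathbb E\big[\sum_{h=0}^{H-1}c(s_h)\big]$ be its expected total cost under $P^\star$, and for a kernel $P$ let $d^\pi_P(s,a)=\frac1H\sum_{h=0}^{H-1}\Pr(s_h=s,a_h=a\mid s_0,\pi,P)$, with state marginal $d^\pi_P(s)$. Let $\Pi$ be a nonempty class of such policies. For trajectories $\tau^0,\dots,\tau^{t-1}$, $\tau^i=(s^i_0,a^i_0,\dots,a^i_{H-1},s^i_H)$, let $N_t(s,a)$ and $N_t(s,a,s')$ be the numbers of occurrences of $(s,a)$ and of $(s,a,s')$; put $\widehat P_t(s'\mid s,a)=N_t(s,a,s')/N_t(s,a)$ (an arbitrary fixed default distribution if $N_t(s,a)=0$) and, for a constant $\kappa>0$ and $\delta\in(0,1]$, $$\sigma_t(s,a)=\kappa\sqrt{\frac{S\ln(t^2SA/\delta)}{N_t(s,a)}}\qquad(+\infty\text{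 if }N_t(s,a)=0).$$ The information gain is $$\mathcal I_T=\sup_{\mathrm{Alg}}\mathbb E_{\mathrm{Alg}}\Big[\sum_{t=0}^{T-1}\sum_{h=0}^{H-1}\min\{\sigma_t^2(s^t_h,a^t_h),1\}\Big],$$ the supremum being over all adaptive algorithms, i.e. maps from the trajectories before iteration $t$ to the policy $\pi_t\in\Pi$ that generates $\tau^t$ under $P^\star$. **(i)** For every $\kappa>0$ there is a constant $C$, depending on $\kappa$ only, such that for all such MDPs, all $\Pi$, $T\ge1$ and $\delta\in(0,1]$, $$\mathcal I_T\le C\,H S^2A\,\ln(2TSA/\delta)\,\ln(1+TH),\qquad\text{i.e. } \mathcal I_T=\widetilde O(HS^2A).$$ **(ii)** Let $\pi^e\in\Pi$ be any expert policy, $\mathcal F$ a finite class of functions $\mathcal S\to[0,1]$ with $c\in\mathcal F$, and $s^e_1,\dots,s^e_N$ ($N\ge1$) i.i.d. states drawn from $d^{\pi^e}_{P^\star}$. Take $\delta=1/(HT)$ and $b_t(s,a)=H\min\{\sigma_t(s,a),2\}$. The algorithm starts from any $\pi_0\in\Pi$; in iteration $t=0,\dots,T-1$ it executes $\pi_t$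 in the true MDP for one trajectory $\tau^t$, and for $t\ge1$ $$\pi_t\in\arg\min_{\pi\in\Pi}\max_{f\in\mathcal F}\Big\{\mathbb E_{(s,a)\sim d^\pi_{\widehat P_t}}[f(s)-b_t(s,a)]-\frac1N\sum_{i=1}^Nf(s_i^e)\Big\}$$ (ties broken by any rule depending on the past trajectories and the expert data). There is a universal $\kappa_0>0$ such that for every $\kappa\ge\kappa_0$ there is a constant $C$, depending on $\kappa$ only, with $$\mathbb E\Big[\min_{0\le t\le T-1}V^{\pi_t}-V^{\pi^e}\Big]\le C\,\ln(2SAHT)\left(\frac{H^3S\sqrt A}{\sqrt T}+H\sqrt{\frac{\ln|\mathcal F|}{N}}\right)$$ for all such MDPs, $\Pi$, $\pi^e$, $\mathcal F$, $N$ and $T\ge1$; that is, the left-hand side is $\widetilde O\big(H^3S\sqrt A/\sqrt T+H\sqrt{\ln|\mathcal F|/N}\big)$. -/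

import Mathlib

open scoped BigOperators

noncomputable section

namespace ILFO

/-- A (stochastic) transition kernel on finite state and action spaces. -/
abbrev Kern (S A : Type*) [Fintype S] := S → A → stdSimplex ℝ S

/-- A stationary (stochastic) policy. -/
abbrev Policy (S A : Type*) [Fintype A] := S → stdSimplex ℝ A

/-- A tabular episodic finite-horizon MDP with fixed initial state and state-dependent cost. -/
structure TabularMDP (S A : Type*) [Fintype S] where
  /-- the true transition kernel -/
  P : Kern S A
  /-- the horizon -/
  H : ℕ
  H_pos : 0 < H
  /-- the cost -/
  c : S → ℝ
  c_mem : ∀ s, c s ∈ Set.Icc (0 : ℝ) 1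
  /-- the initial state -/
  s₀ : S

/-- A trajectory: the states `s_0, …, s_H` and the actions `a_0, …, a_{H-1}`. -/
abbrev Traj (S A : Type*) (H : ℕ) := (Fin (H + 1) → S) × (Fin H → A)

section Dynamics

variable {S A : Type*} [Fintype S] [Fintype A]

open Classical in
/-- The probability of the trajectory `τ` when `π` is run from `s₀` under the transitions `P`. -/
def trajProb (P : Kern S A) (s₀ : S) {H : ℕ} (π : Policy S A) (τ : Traj S A H) : ℝ :=
  (if τ.1 0 = s₀ then 1 else 0) *
    ∏ h : Fin H, (π (τ.1 h.castSucc)).1 (τ.2 h) *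
      (P (τ.1 h.castSucc) (τ.2 h)).1 (τ.1 h.succ)

open Classical in
/-- The average state-action distribution `d^π_P(s,a) = (1/H) ∑_{h<H} Pr(s_h = s, a_h = a)`. -/
def occupancy (P : Kern S A) (s₀ : S) (H : ℕ) (π : Policy S A) (s : S) (a : A) : ℝ :=
  (1 / (H : ℝ)) * ∑ h : Fin H, ∑ τ : Traj S A H,
    if τ.1 h.castSucc = s ∧ τ.2 h = a then trajProb P s₀ π τ else 0

/-- The state marginal `d^π_P(s)`. -/
def stateOccupancy (P : Kern S A) (s₀ : S) (H : ℕ) (π : Policy S A) (s : S) : ℝ :=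
  ∑ a, occupancy P s₀ H π s a

/-- The expected total cost `V^π = E[∑_{h<H} c(s_h)]` under the true dynamics and cost. -/
def TabularMDP.value (M : TabularMDP S A) (π : Policy S A) : ℝ :=
  ∑ τ : Traj S A M.H, trajProb M.P M.s₀ π τ * ∑ h : Fin M.H, M.c (τ.1 h.castSucc)

end Dynamics

section Empirical

variable {S A : Type*} {H t : ℕ}

open Classical in
/-- `N_t(s,a)`: the number of visits of `(s,a)` in the first `t` trajectories. -/
def visits (D : Fin t → Traj S A H) (s : S) (a : A) : ℕ :=
  (Finset.univ.filter fun p : Fin t × Fin H =>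
    (D p.1).1 p.2.castSucc = s ∧ (D p.1).2 p.2 = a).card

open Classical in
/-- `N_t(s,a,s')`: the number of transitions `(s,a,s')` in the first `t` trajectories. -/
def transitions (D : Fin t → Traj S A H) (s : S) (a : A) (s' : S) : ℕ :=
  (Finset.univ.filter fun p : Fin t × Fin H =>
    ((D p.1).1 p.2.castSucc = s ∧ (D p.1).2 p.2 = a) ∧ (D p.1).1 p.2.succ = s').card

theorem sum_transitions [Fintype S] (D : Fin t → Traj S A H) (s : S) (a : A) :
    ∑ s', transitions D s a s' = visits D s a := by
  classical
  unfold transitions visits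
  rw [Finset.card_eq_sum_card_fiberwise
    (f := fun p : Fin t × Fin H => (D p.1).1 p.2.succ) (t := Finset.univ) (by simp)]
  refine Finset.sum_congr rfl fun s' _ => ?_
  rw [Finset.filter_filter]

/-- The empirical transitions `N_t(s,a,s') / N_t(s,a)`; at pairs that have not been visited yet
the estimate is that of the default kernel `P₀`. -/
def empirical [Fintype S] (P₀ : Kern S A) (D : Fin t → Traj S A H) : Kern S A := fun s a =>
  if h : visits D s a = 0 then P₀ s a
  else ⟨fun s' => (transitions D s a s' : ℝ) / visits D s a, by
    refine ⟨fun s' => by positivity, ?_⟩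
    rw [← Finset.sum_div, ← Nat.cast_sum, sum_transitions]
    exact div_self (Nat.cast_ne_zero.mpr h)⟩

/-- The uncertainty `σ_t(s,a) = κ √(S ln(t² S A / δ) / N_t(s,a))`. At an unvisited pair the formula
means `+∞`; as only `min(σ,2)` and `min(σ²,1)` are ever used, the value `2` stands for it there. -/
def sigma [Fintype S] [Fintype A] (κ δ : ℝ) (D : Fin t → Traj S A H) (s : S) (a : A) : ℝ :=
  if visits D s a = 0 then 2
  else κ * √((Fintype.card S : ℝ) *
    Real.log ((t : ℝ) ^ 2 * Fintype.card S * Fintype.card A / δ) / visits D s a)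

/-- The bonus `b_t = H min(σ_t, 2)`. -/
def bonus [Fintype S] [Fintype A] (κ δ : ℝ) (D : Fin t → Traj S A H) (s : S) (a : A) : ℝ :=
  (H : ℝ) * min (sigma κ δ D s a) 2

end Empirical

section Algorithms

variable {S A : Type*} [Fintype S] [Fintype A]

/-- An adaptive algorithm: it maps the trajectories of the iterations before `t` to the policy
that is executed at iteration `t`. -/
abbrev Alg (S A : Type*) [Fintype A] (H : ℕ) := (t : ℕ) → (Fin t → Traj S A H) → Policy S A

/-- The trajectories before iteration `t`. -/
def history {H T : ℕ} (ω : Fin T → Traj S A H) (t : Fin T) : Fin t → Traj S A H :=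
  Fin.take t t.2.le ω

/-- The probability that `T` iterations of `alg` in the MDP produce the trajectories `ω`. -/
def runProb (M : TabularMDP S A) (alg : Alg S A M.H) {T : ℕ} (ω : Fin T → Traj S A M.H) : ℝ :=
  ∏ t : Fin T, trajProb M.P M.s₀ (alg t (history ω t)) (ω t)

/-- `E_alg[∑_{t<T} ∑_{h<H} min(σ_t²(s_h^t, a_h^t), 1)]`. -/
def expectedUncertainty (M : TabularMDP S A) (κ δ : ℝ) (T : ℕ) (alg : Alg S A M.H) : ℝ :=
  ∑ ω : Fin T → Traj S A M.H, runProb M alg ω *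
    ∑ t : Fin T, ∑ h : Fin M.H,
      min ((sigma κ δ (history ω t) ((ω t).1 h.castSucc) ((ω t).2 h)) ^ 2) 1

/-- The information gain: the supremum of the above, which lies in `[0, T H]`, over all adaptive
algorithms with policies in the class `Pol`. -/
def infoGain (M : TabularMDP S A) (Pol : Set (Policy S A)) (κ δ : ℝ) (T : ℕ) : ℝ :=
  ⨆ alg : {alg : Alg S A M.H // ∀ t D, alg t D ∈ Pol}, expectedUncertainty M κ δ T alg.1

/-- `L(π, f; P, b, E) = E_{(s,a) ∼ d^π_P}[f(s) - b(s,a)] - E_{s ∼ E}[f(s)]` for expert data `E`. -/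
def objective {N : ℕ} (s₀ : S) (H : ℕ) (P : Kern S A) (b : S → A → ℝ) (E : Fin N → S)
    (π : Policy S A) (f : S → ℝ) : ℝ :=
  (∑ s, ∑ a, occupancy P s₀ H π s a * (f s - b s a)) - (∑ i, f (E i)) / N

/-- `alg` is a run of the min-max imitation algorithm on the expert data `E`, with discriminators
`F`, policies `Pol`, empirical transitions and bonus: it starts from any policy in `Pol`, and
every later policy minimizes `max_{f ∈ F} L(π, f; P̂_t, b_t, E)` over `Pol` (ties are broken
arbitrarily). -/
structure IsMobILE (M : TabularMDP S A) (F : Finset (S → ℝ)) (Pol : Set (Policy S A))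
    (P₀ : Kern S A) (κ δ : ℝ) {N : ℕ} (E : Fin N → S) (alg : Alg S A M.H) : Prop where
  mem : ∀ t D, alg t D ∈ Pol
  isMin : ∀ (t : ℕ), 0 < t → ∀ D : Fin t → Traj S A M.H,
    IsMinOn (fun π => ⨆ f : F, objective M.s₀ M.H (empirical P₀ D) (bonus κ δ D) E π f.1)
      Pol (alg t D)

/-- The probability of the expert data `E`: `N` i.i.d. states drawn from `d^{πe}`. -/
def expertProb (M : TabularMDP S A) (πe : Policy S A) {N : ℕ} (E : Fin N → S) : ℝ :=
  ∏ i, stateOccupancy M.P M.s₀ M.H πe (E i)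

/-- `E[min_{t<T} V^{π_t} - V^{πe}]`, the expectation being over the expert data and the run. -/
def expectedGap (M : TabularMDP S A) (πe : Policy S A) (N T : ℕ)
    (alg : (Fin N → S) → Alg S A M.H) : ℝ :=
  ∑ E : Fin N → S, expertProb M πe E *
    ∑ ω : Fin T → Traj S A M.H, runProb M (alg E) ω *
      ((⨅ t : Fin T, M.value (alg E t (history ω t))) - M.value πe)

end Algorithms

end ILFO

end

/-!
The information gain is bounded on every run. Fix a pair `(s,a)` and put `B = κ² S L`, with `L` an
upper bound of the logarithm in `σ_t`. Then `min(σ_t², 1) ≤ (B + H) / (N_t + H)`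
(`ILFO.min_sigma_sq_le`); since an iteration adds at most `H` visits, the relative increments of
`N_t + H` are at most `1`, and their sum telescopes to `2 ln(1 + T)`
(`ILFO.sum_trajVisits_div_le`). Summing over the pairs gives `ILFO.sum_min_sigma_sq_le`.

For the imitation bound, suppose that the `ℓ¹` error of `P̂_t` is at most `min(σ_t, 2)` everywhere.
The bonus then makes `P̂_t` optimistic (`ILFO.valueFn_sub_bonus_le`), so that the objective of the
expert is at most the largest deviation of the expert data. The executed policy does no worse on
the objective, with the true cost as discriminator; the simulation lemma (`ILFO.valueFn_sub_le`)
carries this back to the true dynamics at the price of `3 H² ∑_h min(σ_t, 2)` along the executed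
trajectory (`ILFO.gap_le_of_not_confFails`). The minimum over `t` is at most the average, and
Cauchy-Schwarz with the pathwise bound above controls the average (`ILFO.sum_min_sigma_le`).

The data are adaptive, so concentration comes from a supermartingale: for a pair `(s,a)` and a
sign vector on the next states, `exp(λ Z_t - 2 λ² N_t)` has mean at most `1` along a run, `Z_t` being
the centred sum of the signs (`ILFO.runExp_prod_le_one`, `ILFO.prod_stepWeight`). A union bound over
the pairs, the `2^S` signs and the values of `N_t`, with `λ` tuned to each value, gives failure
probability at most `1/T` (`ILFO.runExp_confFailInd_le`). The deviation of the expert data is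
bounded in mean by Massart's inequality (`ILFO.sum_prod_mul_iSup_le`). Only this deviation counts: the
error in the cost itself has mean zero, so that nothing is left when `ln |F| = 0`.
-/

namespace ILFO

/-! ### Trajectories, Bellman recursion and model errors -/

section KernelDistance

variable {S A : Type*} [Fintype S]

/-- The `ℓ¹` distance between the next-state distributions of two kernels. -/
noncomputable def kernDist (P Q : Kern S A) (s : S) (a : A) : ℝ :=
  ∑ s', |(P s a).1 s' - (Q s a).1 s'|

theorem kernDist_le_two (P Q : Kern S A) (s : S) (a : A) : kernDist P Q s a ≤ 2 := by
  calc kernDist P Q s a ≤ ∑ s', ((P s a).1 s' + (Q s a).1 s') := by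
        refine Finset.sum_le_sum fun s' _ => ?_
        have h1 := (P s a).2.1 s'
        have h2 := (Q s a).2.1 s'
        exact abs_le.2 ⟨by linarith, by linarith⟩
    _ = 2 := by rw [Finset.sum_add_distrib, (P s a).2.2, (Q s a).2.2]; norm_num

theorem abs_sum_kern_sub_le (P Q : Kern S A) (s : S) (a : A) {g : S → ℝ} {k : ℝ}
    (hg : ∀ s, |g s| ≤ k) :
    |∑ s', (P s a).1 s' * g s' - ∑ s', (Q s a).1 s' * g s'| ≤ k * kernDist P Q s a := by
  rw [← Finset.sum_sub_distrib, kernDist, Finset.mul_sum]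
  refine (Finset.abs_sum_le_sum_abs _ _).trans (Finset.sum_le_sum fun s' _ => ?_)
  rw [← sub_mul, abs_mul, mul_comm]
  exact mul_le_mul_of_nonneg_right (hg s') (abs_nonneg _)

end KernelDistance

section Trajectories

variable {S A : Type*} [Fintype S] [Fintype A]

theorem trajProb_nonneg (P : Kern S A) (s₀ : S) {H : ℕ} (π : Policy S A) (τ : Traj S A H) :
    0 ≤ trajProb P s₀ π τ := by
  unfold trajProb
  refine mul_nonneg (by split_ifs <;> norm_num) (Finset.prod_nonneg fun h _ => ?_)
  exact mul_nonneg ((π _).2.1 _) ((P _ _).2.1 _)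

theorem trajProb_eq_zero (P : Kern S A) {s₀ : S} {H : ℕ} (π : Policy S A) {τ : Traj S A H}
    (h : τ.1 0 ≠ s₀) : trajProb P s₀ π τ = 0 := by
  simp [trajProb, h]

/-- The expectation of `f` over the trajectory of `π` from `s₀` under the transitions `P`. -/
noncomputable def trajExp (P : Kern S A) (π : Policy S A) {H : ℕ} (s₀ : S)
    (f : Traj S A H → ℝ) : ℝ :=
  ∑ τ : Traj S A H, trajProb P s₀ π τ * f τ

theorem trajExp_congr (P : Kern S A) (π : Policy S A) {H : ℕ} {s₀ : S} {f g : Traj S A H → ℝ}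
    (h : ∀ τ, τ.1 0 = s₀ → f τ = g τ) : trajExp P π s₀ f = trajExp P π s₀ g := by
  refine Finset.sum_congr rfl fun τ _ => ?_
  by_cases h0 : τ.1 0 = s₀
  · rw [h τ h0]
  · rw [trajProb_eq_zero P π h0, zero_mul, zero_mul]

theorem trajExp_const_mul (P : Kern S A) (π : Policy S A) {H : ℕ} (s₀ : S) (k : ℝ)
    (f : Traj S A H → ℝ) : trajExp P π s₀ (fun τ => k * f τ) = k * trajExp P π s₀ f := by
  simp only [trajExp, Finset.mul_sum]
  exact Finset.sum_congr rfl fun τ _ => by ring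

theorem trajExp_add (P : Kern S A) (π : Policy S A) {H : ℕ} (s₀ : S)
    (f g : Traj S A H → ℝ) :
    trajExp P π s₀ (fun τ => f τ + g τ) = trajExp P π s₀ f + trajExp P π s₀ g := by
  simp only [trajExp, mul_add, Finset.sum_add_distrib]

/-- The trajectory that starts with the state `s` and the action `a` and continues with `τ`. -/
def consTraj {H : ℕ} (s : S) (a : A) (τ : Traj S A H) : Traj S A (H + 1) :=
  (Fin.cons s τ.1, Fin.cons a τ.2)

theorem sum_traj_succ {H : ℕ} (f : Traj S A (H + 1) → ℝ) :
    ∑ τ, f τ = ∑ s, ∑ a, ∑ τ : Traj S A H, f (consTraj s a τ) := by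
  let e : S × A × Traj S A H ≃ Traj S A (H + 1) :=
    { toFun := fun p => consTraj p.1 p.2.1 p.2.2
      invFun := fun τ => (τ.1 0, τ.2 0, (Fin.tail τ.1, Fin.tail τ.2))
      left_inv := fun p => by simp [consTraj]
      right_inv := fun τ => by simp [consTraj] }
  rw [← e.sum_comp f, Fintype.sum_prod_type]
  refine Finset.sum_congr rfl fun s _ => ?_
  rw [Fintype.sum_prod_type]
  rfl

open Classical in
theorem trajProb_consTraj (P : Kern S A) (s₀ : S) {H : ℕ} (π : Policy S A) (s : S) (a : A)
    (τ : Traj S A H) :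
    trajProb P s₀ π (consTraj s a τ) =
      if s = s₀ then (π s).1 a * ∑ s', (P s a).1 s' * trajProb P s' π τ else 0 := by
  have h1 : ∑ s', (P s a).1 s' * trajProb P s' π τ =
      (P s a).1 (τ.1 0) * ∏ h : Fin H, (π (τ.1 h.castSucc)).1 (τ.2 h) *
        (P (τ.1 h.castSucc) (τ.2 h)).1 (τ.1 h.succ) := by
    rw [Finset.sum_eq_single (τ.1 0)]
    · simp [trajProb]
    · intro s' _ hs'
      rw [trajProb_eq_zero P π (Ne.symm hs'), mul_zero]
    · simp
  rw [h1, trajProb, Fin.prod_univ_succ]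
  by_cases hs : s = s₀ <;> simp [consTraj, hs, mul_assoc]

/-- The Markov property at the first step. -/
theorem trajExp_succ (P : Kern S A) (π : Policy S A) {H : ℕ} (s₀ : S)
    (f : Traj S A (H + 1) → ℝ) :
    trajExp P π s₀ f = ∑ a, (π s₀).1 a * ∑ s', (P s₀ a).1 s' *
      trajExp P π s' (fun τ => f (consTraj s₀ a τ)) := by
  classical
  rw [trajExp, sum_traj_succ, Finset.sum_eq_single s₀]
  · refine Finset.sum_congr rfl fun a _ => ?_
    simp only [trajProb_consTraj, if_true, trajExp, Finset.mul_sum, Finset.sum_mul]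
    rw [Finset.sum_comm]
    refine Finset.sum_congr rfl fun s' _ => Finset.sum_congr rfl fun τ _ => by ring
  · intro s _ hs
    simp [trajProb_consTraj, hs]
  · simp

theorem trajExp_zero (P : Kern S A) (π : Policy S A) (s₀ : S) (f : Traj S A 0 → ℝ) :
    trajExp P π s₀ f = f (fun _ => s₀, Fin.elim0) := by
  classical
  rw [trajExp, Finset.sum_eq_single (fun _ => s₀, Fin.elim0)]
  · simp [trajProb]
  · intro τ _ hτ
    rw [trajProb_eq_zero, zero_mul]
    intro h
    apply hτ
    ext i
    · rw [show i = 0 from Fin.fin_one_eq_zero i, h]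
    · exact i.elim0
  · simp

theorem trajExp_const (P : Kern S A) (π : Policy S A) {H : ℕ} (s₀ : S) (k : ℝ) :
    trajExp P π s₀ (fun _ : Traj S A H => k) = k := by
  induction H generalizing s₀ with
  | zero => rw [trajExp_zero]
  | succ H ih =>
    rw [trajExp_succ]
    simp only [ih, ← Finset.sum_mul, (P _ _).2.2, (π _).2.2, one_mul]

/-- A product of factors `w(s_h, a_h, s_{h+1})`, each of conditional mean at most `1`, has mean
at most `1`. -/
theorem trajExp_prod_le_one (P : Kern S A) (π : Policy S A) {H : ℕ} (s₀ : S)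
    (w : S → A → S → ℝ) (hw : ∀ s a s', 0 ≤ w s a s')
    (h1 : ∀ s a, ∑ s', (P s a).1 s' * w s a s' ≤ 1) :
    trajExp P π s₀ (fun τ : Traj S A H =>
      ∏ h : Fin H, w (τ.1 h.castSucc) (τ.2 h) (τ.1 h.succ)) ≤ 1 := by
  induction H generalizing s₀ with
  | zero => simp [trajExp_zero]
  | succ H ih =>
    rw [trajExp_succ, ← (π s₀).2.2]
    refine Finset.sum_le_sum fun a _ => mul_le_of_le_one_right ((π s₀).2.1 a) ?_
    refine le_trans (Finset.sum_le_sum fun s' _ => ?_) (h1 s₀ a)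
    refine mul_le_mul_of_nonneg_left ?_ ((P s₀ a).2.1 s')
    have h2 : trajExp P π s' (fun τ : Traj S A H => ∏ h : Fin (H + 1),
          w ((consTraj s₀ a τ).1 h.castSucc) ((consTraj s₀ a τ).2 h)
            ((consTraj s₀ a τ).1 h.succ)) =
        trajExp P π s' (fun τ : Traj S A H => w s₀ a s' *
          ∏ h : Fin H, w (τ.1 h.castSucc) (τ.2 h) (τ.1 h.succ)) := by
      refine trajExp_congr P π fun τ hτ => ?_
      rw [Fin.prod_univ_succ]
      simp [consTraj, hτ]
    rw [h2, trajExp_const_mul]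
    exact mul_le_of_le_one_right (hw _ _ _) (ih s')

/-- The expected total reward of `π` over `n` steps from `s`, by the Bellman recursion. -/
noncomputable def valueFn (P : Kern S A) (π : Policy S A) (r : S → A → ℝ) : ℕ → S → ℝ
  | 0, _ => 0
  | n + 1, s => ∑ a, (π s).1 a * (r s a + ∑ s', (P s a).1 s' * valueFn P π r n s')

theorem trajExp_sum_eq_valueFn (P : Kern S A) (π : Policy S A) (r : S → A → ℝ) {H : ℕ} (s₀ : S) :
    trajExp P π s₀ (fun τ : Traj S A H => ∑ h : Fin H, r (τ.1 h.castSucc) (τ.2 h)) =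
      valueFn P π r H s₀ := by
  induction H generalizing s₀ with
  | zero => simp [trajExp_zero, valueFn]
  | succ H ih =>
    rw [trajExp_succ, valueFn]
    refine Finset.sum_congr rfl fun a _ => ?_
    congr 1
    have h2 : ∀ s', trajExp P π s' (fun τ : Traj S A H => ∑ h : Fin (H + 1),
          r ((consTraj s₀ a τ).1 h.castSucc) ((consTraj s₀ a τ).2 h)) =
        r s₀ a + valueFn P π r H s' := by
      intro s'
      rw [← ih s', ← trajExp_const P π (H := H) s' (r s₀ a), ← trajExp_add]
      refine trajExp_congr P π fun τ hτ => ?_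
      rw [Fin.sum_univ_succ]
      simp [consTraj]
    simp only [h2, mul_add, Finset.sum_add_distrib, ← Finset.sum_mul, (P s₀ a).2.2, one_mul]

theorem valueFn_nonneg (P : Kern S A) (π : Policy S A) {r : S → A → ℝ} (hr : ∀ s a, 0 ≤ r s a)
    (n : ℕ) (s : S) : 0 ≤ valueFn P π r n s := by
  induction n generalizing s with
  | zero => simp [valueFn]
  | succ n ih =>
    refine Finset.sum_nonneg fun a _ => mul_nonneg ((π s).2.1 a) (add_nonneg (hr s a) ?_)
    exact Finset.sum_nonneg fun s' _ => mul_nonneg ((P s a).2.1 s') (ih s')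

theorem abs_valueFn_le (P : Kern S A) (π : Policy S A) {r : S → A → ℝ} {k : ℝ}
    (hr : ∀ s a, |r s a| ≤ k) (n : ℕ) (s : S) : |valueFn P π r n s| ≤ n * k := by
  induction n generalizing s with
  | zero => simp [valueFn]
  | succ n ih =>
    have h1 : ∀ a, |∑ s', (P s a).1 s' * valueFn P π r n s'| ≤ n * k := by
      intro a
      calc |∑ s', (P s a).1 s' * valueFn P π r n s'|
          ≤ ∑ s', (P s a).1 s' * (n * k) := by
            refine (Finset.abs_sum_le_sum_abs _ _).trans (Finset.sum_le_sum fun s' _ => ?_)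
            rw [abs_mul, abs_of_nonneg ((P s a).2.1 s')]
            exact mul_le_mul_of_nonneg_left (ih s') ((P s a).2.1 s')
        _ = n * k := by rw [← Finset.sum_mul, (P s a).2.2, one_mul]
    calc |valueFn P π r (n + 1) s| ≤ ∑ a, (π s).1 a * ((n + 1 : ℕ) * k) := by
            refine (Finset.abs_sum_le_sum_abs _ _).trans (Finset.sum_le_sum fun a _ => ?_)
            rw [abs_mul, abs_of_nonneg ((π s).2.1 a)]
            refine mul_le_mul_of_nonneg_left ?_ ((π s).2.1 a)
            refine (abs_add_le _ _).trans ?_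
            push_cast
            linarith [hr s a, h1 a]
      _ = (n + 1 : ℕ) * k := by rw [← Finset.sum_mul, (π s).2.2, one_mul]

/-- Optimism: subtracting a bonus that dominates the model error makes the cost under the
estimated kernel at most the true one. -/
theorem valueFn_sub_bonus_le (P Q : Kern S A) (π : Policy S A) {f : S → ℝ} {β : S → A → ℝ}
    (H : ℕ) (hf : ∀ s, f s ∈ Set.Icc (0 : ℝ) 1) (hβ : ∀ s a, kernDist Q P s a ≤ β s a)
    {n : ℕ} (hn : n ≤ H) (s : S) :
    valueFn Q π (fun s a => f s - H * β s a) n s ≤ valueFn P π (fun s _ => f s) n s := by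
  induction n generalizing s with
  | zero => simp [valueFn]
  | succ n ih =>
    rw [valueFn, valueFn]
    refine Finset.sum_le_sum fun a _ => mul_le_mul_of_nonneg_left ?_ ((π s).2.1 a)
    have h1 : ∑ s', (Q s a).1 s' * valueFn Q π (fun s a => f s - H * β s a) n s' ≤
        ∑ s', (Q s a).1 s' * valueFn P π (fun s _ => f s) n s' :=
      Finset.sum_le_sum fun s' _ =>
        mul_le_mul_of_nonneg_left (ih (Nat.le_of_succ_le hn) s') ((Q s a).2.1 s')
    have h2 := abs_sum_kern_sub_le Q P s a (k := H)
      (g := valueFn P π (fun s _ => f s) n) (fun s' => by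
        refine (abs_valueFn_le P π (k := 1) (fun s _ => ?_) n s').trans ?_
        · rw [abs_of_nonneg (hf s).1]; exact (hf s).2
        · rw [mul_one]; exact_mod_cast Nat.le_of_succ_le hn)
    have h3 : (H : ℝ) * kernDist Q P s a ≤ H * β s a :=
      mul_le_mul_of_nonneg_left (hβ s a) (Nat.cast_nonneg _)
    linarith [(abs_le.1 h2).2]

/-- The simulation lemma: the true cost exceeds the optimistic one by at most the uncertainty that
is met along the true trajectories. -/
theorem valueFn_sub_le (P Q : Kern S A) (π : Policy S A) {f : S → ℝ} {β : S → A → ℝ}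
    {H : ℕ} (hH : 0 < H) (hf : ∀ s, f s ∈ Set.Icc (0 : ℝ) 1)
    (hβ : ∀ s a, kernDist Q P s a ≤ β s a) (hβ2 : ∀ s a, β s a ≤ 2)
    {n : ℕ} (hn : n ≤ H) (s : S) :
    valueFn P π (fun s _ => f s) n s - valueFn Q π (fun s a => f s - H * β s a) n s ≤
      valueFn P π (fun s a => 3 * (H : ℝ) ^ 2 * β s a) n s := by
  have hH1 : (1 : ℝ) ≤ H := by exact_mod_cast hH
  have hβ0 : ∀ s a, 0 ≤ β s a := fun s a =>
    (Finset.sum_nonneg fun _ _ => abs_nonneg _).trans (hβ s a)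
  induction n generalizing s with
  | zero => simp [valueFn]
  | succ n ih =>
    rw [valueFn, valueFn, valueFn, ← Finset.sum_sub_distrib]
    simp only [← mul_sub]
    refine Finset.sum_le_sum fun a _ => mul_le_mul_of_nonneg_left ?_ ((π s).2.1 a)
    set V := valueFn P π (fun s _ => f s) n
    set W := valueFn Q π (fun s a => f s - H * β s a) n
    set U := valueFn P π (fun s a => 3 * (H : ℝ) ^ 2 * β s a) n
    have h1 : ∑ s', (P s a).1 s' * (V s' - W s') ≤ ∑ s', (P s a).1 s' * U s' :=
      Finset.sum_le_sum fun s' _ =>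
        mul_le_mul_of_nonneg_left (ih (Nat.le_of_succ_le hn) s') ((P s a).2.1 s')
    have h2 := abs_sum_kern_sub_le Q P s a (k := 2 * (H : ℝ) ^ 2) (g := W) (fun s' => by
        refine (abs_valueFn_le Q π (k := 2 * H) (fun s a => abs_le.2 ⟨?_, ?_⟩) n s').trans ?_
        · nlinarith [(hf s).1, hβ2 s a]
        · nlinarith [(hf s).2, hβ0 s a]
        · have : (n : ℝ) ≤ H := by exact_mod_cast Nat.le_of_succ_le hn
          nlinarith)
    simp only [mul_sub, Finset.sum_sub_distrib] at h1
    have h3 : 2 * (H : ℝ) ^ 2 * kernDist Q P s a ≤ 2 * (H : ℝ) ^ 2 * β s a :=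
      mul_le_mul_of_nonneg_left (hβ s a) (by positivity)
    have h4 : (H : ℝ) * β s a ≤ H ^ 2 * β s a :=
      mul_le_mul_of_nonneg_right (by nlinarith) (hβ0 s a)
    linarith [(abs_le.1 h2).1]

theorem sum_occupancy_mul (P : Kern S A) (s₀ : S) (H : ℕ) (π : Policy S A) (r : S → A → ℝ) :
    ∑ s, ∑ a, occupancy P s₀ H π s a * r s a = 1 / (H : ℝ) * valueFn P π r H s₀ := by
  classical
  rw [← trajExp_sum_eq_valueFn, trajExp]
  simp only [occupancy, Finset.mul_sum, Finset.sum_mul]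
  have h1 : ∀ s a, ∑ h : Fin H, ∑ τ : Traj S A H, 1 / (H : ℝ) *
        (if τ.1 h.castSucc = s ∧ τ.2 h = a then trajProb P s₀ π τ else 0) * r s a =
      ∑ τ : Traj S A H, ∑ h : Fin H, 1 / (H : ℝ) *
        (if τ.1 h.castSucc = s ∧ τ.2 h = a then trajProb P s₀ π τ else 0) * r s a :=
    fun s a => Finset.sum_comm
  simp only [h1]
  rw [Finset.sum_congr rfl fun s _ => Finset.sum_comm, Finset.sum_comm]
  refine Finset.sum_congr rfl fun τ _ => ?_
  rw [Finset.sum_congr rfl fun s _ => Finset.sum_comm, Finset.sum_comm]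
  refine Finset.sum_congr rfl fun h _ => ?_
  rw [Finset.sum_eq_single (τ.1 h.castSucc), Finset.sum_eq_single (τ.2 h)]
  · simp [mul_assoc]
  · intro a _ ha
    simp [Ne.symm ha]
  · simp
  · intro s _ hs
    simp [Ne.symm hs]
  · simp

theorem occupancy_nonneg (P : Kern S A) (s₀ : S) (H : ℕ) (π : Policy S A) (s : S) (a : A) :
    0 ≤ occupancy P s₀ H π s a := by
  refine mul_nonneg (by positivity) (Finset.sum_nonneg fun h _ => Finset.sum_nonneg fun τ _ => ?_)
  split_ifs
  exacts [trajProb_nonneg P s₀ π τ, le_rfl]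

theorem stateOccupancy_nonneg (P : Kern S A) (s₀ : S) (H : ℕ) (π : Policy S A) (s : S) :
    0 ≤ stateOccupancy P s₀ H π s :=
  Finset.sum_nonneg fun a _ => occupancy_nonneg P s₀ H π s a

theorem sum_stateOccupancy_mul (P : Kern S A) (s₀ : S) (H : ℕ) (π : Policy S A) (f : S → ℝ) :
    ∑ s, stateOccupancy P s₀ H π s * f s =
      1 / (H : ℝ) * valueFn P π (fun s _ => f s) H s₀ := by
  rw [← sum_occupancy_mul]
  simp only [stateOccupancy, Finset.sum_mul]

theorem sum_stateOccupancy (P : Kern S A) (s₀ : S) {H : ℕ} (hH : 0 < H) (π : Policy S A) :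
    ∑ s, stateOccupancy P s₀ H π s = 1 := by
  have h1 := sum_stateOccupancy_mul P s₀ H π (fun _ => 1)
  have hH' : (H : ℝ) ≠ 0 := by exact_mod_cast hH.ne'
  rw [← trajExp_sum_eq_valueFn] at h1
  simpa [trajExp_const, hH'] using h1

theorem TabularMDP.value_eq_valueFn (M : TabularMDP S A) (π : Policy S A) :
    M.value π = valueFn M.P π (fun s _ => M.c s) M.H M.s₀ :=
  trajExp_sum_eq_valueFn M.P π (fun s _ => M.c s) M.s₀

end Trajectories

/-! ### Runs of an adaptive algorithm -/

section History

variable {S A : Type*}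

theorem history_snoc_castSucc {H T : ℕ} (D : Fin T → Traj S A H) (τ : Traj S A H) (t : Fin T) :
    history (Fin.snoc (α := fun _ => Traj S A H) D τ) t.castSucc = history D t := by
  funext i
  exact Fin.snoc_castSucc (α := fun _ => Traj S A H) τ D (Fin.castLE t.2.le i)

theorem history_snoc_last {H T : ℕ} (D : Fin T → Traj S A H) (τ : Traj S A H) :
    history (Fin.snoc (α := fun _ => Traj S A H) D τ) (Fin.last T) = D := by
  funext i
  exact Fin.snoc_castSucc (α := fun _ => Traj S A H) τ D i

end History

section Runs

variable {S A : Type*} [Fintype S] [Fintype A]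

/-- The expectation of `f` over `T` iterations of `alg` in the MDP. -/
noncomputable def runExp (M : TabularMDP S A) (alg : Alg S A M.H) {T : ℕ}
    (f : (Fin T → Traj S A M.H) → ℝ) : ℝ :=
  ∑ ω, runProb M alg ω * f ω

theorem runProb_nonneg (M : TabularMDP S A) (alg : Alg S A M.H) {T : ℕ}
    (ω : Fin T → Traj S A M.H) : 0 ≤ runProb M alg ω :=
  Finset.prod_nonneg fun _ _ => trajProb_nonneg _ _ _ _

theorem runExp_mono (M : TabularMDP S A) (alg : Alg S A M.H) {T : ℕ}
    {f g : (Fin T → Traj S A M.H) → ℝ} (h : ∀ ω, f ω ≤ g ω) : runExp M alg f ≤ runExp M alg g :=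
  Finset.sum_le_sum fun ω _ => mul_le_mul_of_nonneg_left (h ω) (runProb_nonneg M alg ω)

theorem runExp_const_mul (M : TabularMDP S A) (alg : Alg S A M.H) {T : ℕ} (k : ℝ)
    (f : (Fin T → Traj S A M.H) → ℝ) : runExp M alg (fun ω => k * f ω) = k * runExp M alg f := by
  simp only [runExp, Finset.mul_sum]
  exact Finset.sum_congr rfl fun ω _ => by ring

theorem runExp_add (M : TabularMDP S A) (alg : Alg S A M.H) {T : ℕ}
    (f g : (Fin T → Traj S A M.H) → ℝ) :
    runExp M alg (fun ω => f ω + g ω) = runExp M alg f + runExp M alg g := by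
  simp only [runExp, mul_add, Finset.sum_add_distrib]

theorem runExp_sum (M : TabularMDP S A) (alg : Alg S A M.H) {T : ℕ} {ι : Type*} (s : Finset ι)
    (f : ι → (Fin T → Traj S A M.H) → ℝ) :
    runExp M alg (fun ω => ∑ i ∈ s, f i ω) = ∑ i ∈ s, runExp M alg (f i) := by
  simp only [runExp, Finset.mul_sum]
  exact Finset.sum_comm

theorem runExp_succ (M : TabularMDP S A) (alg : Alg S A M.H) {T : ℕ}
    (f : (Fin (T + 1) → Traj S A M.H) → ℝ) :
    runExp M alg f = runExp M alg (fun D : Fin T → Traj S A M.H =>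
      trajExp M.P (alg T D) M.s₀ (fun τ => f (Fin.snoc (α := fun _ => Traj S A M.H) D τ))) := by
  rw [runExp, ← (Fin.snocEquiv (fun _ => Traj S A M.H)).sum_comp, Fintype.sum_prod_type,
    Finset.sum_comm]
  refine Finset.sum_congr rfl fun D _ => ?_
  simp only [trajExp, Finset.mul_sum]
  refine Finset.sum_congr rfl fun τ _ => ?_
  have h1 : runProb M alg (Fin.snoc (α := fun _ => Traj S A M.H) D τ) =
      runProb M alg D * trajProb M.P M.s₀ (alg T D) τ := by
    rw [runProb, Fin.prod_univ_castSucc, history_snoc_last, Fin.snoc_last]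
    congr 1
    refine Finset.prod_congr rfl fun t _ => ?_
    rw [history_snoc_castSucc, Fin.snoc_castSucc]
    rfl
  change runProb M alg (Fin.snoc (α := fun _ => Traj S A M.H) D τ) * f _ = _
  rw [h1, mul_assoc]
  rfl

theorem runExp_zero (M : TabularMDP S A) (alg : Alg S A M.H)
    (f : (Fin 0 → Traj S A M.H) → ℝ) : runExp M alg f = f Fin.elim0 := by
  rw [runExp, Finset.sum_eq_single Fin.elim0]
  · simp [runProb]
  · intro ω _ h
    exact absurd (Subsingleton.elim _ _) h
  · exact fun h => absurd (Finset.mem_univ _) h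

theorem runExp_const (M : TabularMDP S A) (alg : Alg S A M.H) {T : ℕ} (k : ℝ) :
    runExp M alg (fun _ : Fin T → Traj S A M.H => k) = k := by
  induction T with
  | zero => rw [runExp_zero]
  | succ T ih => rw [runExp_succ]; simpa only [trajExp_const] using ih

/-- The trajectory of iteration `t` is generated by the policy that is chosen from the history. -/
theorem runExp_history (M : TabularMDP S A) (alg : Alg S A M.H) {T : ℕ} (t : Fin T)
    (g : (Fin t → Traj S A M.H) → Traj S A M.H → ℝ) :
    runExp M alg (fun ω : Fin T → Traj S A M.H => g (history ω t) (ω t)) =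
      runExp M alg (fun D : Fin t → Traj S A M.H => trajExp M.P (alg t D) M.s₀ (g D)) := by
  induction T with
  | zero => exact t.elim0
  | succ T ih =>
    rw [runExp_succ]
    induction t using Fin.lastCases with
    | last => simp only [history_snoc_last, Fin.snoc_last]; rfl
    | cast t =>
      simp only [history_snoc_castSucc, Fin.snoc_castSucc, trajExp_const]
      exact ih t g

theorem runExp_prod_le_one (M : TabularMDP S A) (alg : Alg S A M.H) {T : ℕ}
    (w : S → A → S → ℝ) (hw : ∀ s a s', 0 ≤ w s a s')
    (h1 : ∀ s a, ∑ s', (M.P s a).1 s' * w s a s' ≤ 1) :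
    runExp M alg (fun ω : Fin T → Traj S A M.H => ∏ t : Fin T, ∏ h : Fin M.H,
      w ((ω t).1 h.castSucc) ((ω t).2 h) ((ω t).1 h.succ)) ≤ 1 := by
  induction T with
  | zero => simp [runExp_zero]
  | succ T ih =>
    rw [runExp_succ]
    refine le_trans (runExp_mono M alg fun D => ?_) ih
    simp only [Fin.prod_univ_castSucc, Fin.snoc_castSucc, Fin.snoc_last]
    rw [trajExp_const_mul]
    refine mul_le_of_le_one_right ?_ (trajExp_prod_le_one M.P _ M.s₀ w hw h1)
    exact Finset.prod_nonneg fun t _ => Finset.prod_nonneg fun h _ => hw _ _ _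

end Runs

/-! ### Visit counts and the information gain -/

section Counting

variable {S A : Type*} {H : ℕ}

open Classical in
/-- The number of visits of `(s,a)` in one trajectory. -/
noncomputable def trajVisits (τ : Traj S A H) (s : S) (a : A) : ℕ :=
  (Finset.univ.filter fun h : Fin H => τ.1 h.castSucc = s ∧ τ.2 h = a).card

theorem trajVisits_le (τ : Traj S A H) (s : S) (a : A) : trajVisits τ s a ≤ H := by
  classical
  exact (Finset.card_filter_le _ _).trans (by simp)

theorem visits_eq_sum {t : ℕ} (D : Fin t → Traj S A H) (s : S) (a : A) :
    visits D s a = ∑ i, trajVisits (D i) s a := by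
  simp only [visits, trajVisits, Finset.card_filter, Fintype.sum_prod_type]

theorem visits_le {t : ℕ} (D : Fin t → Traj S A H) (s : S) (a : A) : visits D s a ≤ t * H := by
  rw [visits_eq_sum]
  exact (Finset.sum_le_sum fun i _ => trajVisits_le (D i) s a).trans (by simp)

theorem sum_steps_eq_sum_pairs [Fintype S] [Fintype A] (τ : Traj S A H) (g : S → A → ℝ) :
    ∑ h : Fin H, g (τ.1 h.castSucc) (τ.2 h) = ∑ s, ∑ a, (trajVisits τ s a : ℝ) * g s a := by
  classical
  simp only [trajVisits, Finset.card_filter, Nat.cast_sum, Finset.sum_mul]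
  rw [Finset.sum_congr rfl fun s _ => Finset.sum_comm, Finset.sum_comm]
  refine Finset.sum_congr rfl fun h _ => ?_
  rw [Finset.sum_eq_single (τ.1 h.castSucc), Finset.sum_eq_single (τ.2 h)]
  · simp
  · intro a _ ha
    simp [Ne.symm ha]
  · simp
  · intro s _ hs
    simp [Ne.symm hs]
  · simp

theorem div_le_two_mul_log_sub {x y : ℝ} (hx : 0 ≤ x) (hxy : x ≤ y) (hy : 0 < y) :
    x / y ≤ 2 * (Real.log (y + x) - Real.log y) := by
  rw [← Real.log_div (by positivity) hy.ne']
  have h1 := Real.one_sub_inv_le_log_of_pos (x := (y + x) / y) (by positivity)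
  have h2 : x / y ≤ 2 * (1 - ((y + x) / y)⁻¹) := by
    have h3 : 2 * (1 - ((y + x) / y)⁻¹) = 2 * x / (y + x) := by
      field_simp
      ring
    rw [h3, div_le_div_iff₀ hy (by positivity)]
    nlinarith
  linarith

/-- As at most `H` visits are added per iteration, the relative increments of `N_t + H` are at
most `1`, and their sum telescopes to a logarithm. -/
theorem sum_trajVisits_div_le (hH : 0 < H) {T : ℕ} (ω : Fin T → Traj S A H) (s : S) (a : A) :
    ∑ t : Fin T, (trajVisits (ω t) s a : ℝ) / (visits (history ω t) s a + H) ≤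
      2 * (Real.log (visits ω s a + H) - Real.log H) := by
  have hH' : (0 : ℝ) < H := by exact_mod_cast hH
  induction T with
  | zero => simp [visits]
  | succ T ih =>
    have h1 := ih (Fin.init ω)
    have h2 := div_le_two_mul_log_sub (x := trajVisits (ω (Fin.last T)) s a)
      (y := visits (Fin.init ω) s a + H) (by positivity)
      (by
        have : (trajVisits (ω (Fin.last T)) s a : ℝ) ≤ H := by
          exact_mod_cast trajVisits_le _ s a
        linarith [Nat.cast_nonneg (α := ℝ) (visits (Fin.init ω) s a)]) (by positivity)
    have h3 : (visits ω s a : ℝ) = visits (Fin.init ω) s a + trajVisits (ω (Fin.last T)) s a := by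
      rw [visits_eq_sum, visits_eq_sum, Fin.sum_univ_castSucc]
      push_cast
      rfl
    rw [Fin.sum_univ_castSucc, h3, add_right_comm]
    change ∑ t : Fin T, (trajVisits (Fin.init ω t) s a : ℝ) /
        (visits (history (Fin.init ω) t) s a + H) +
      (trajVisits (ω (Fin.last T)) s a : ℝ) / (visits (Fin.init ω) s a + H) ≤ _
    linarith

end Counting

section Pathwise

variable {S A : Type*} [Fintype S] [Fintype A] {H : ℕ}

theorem card_pos_of_policy (M : TabularMDP S A) (π : Policy S A) : 0 < Fintype.card A := by
  rw [Fintype.card_pos_iff]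
  by_contra h
  rw [not_nonempty_iff] at h
  simpa using (π M.s₀).2.2

theorem log_le_two_mul_log {t T : ℕ} (htT : t ≤ T) {x δ : ℝ} (hx : 1 ≤ x) (hδ : 0 < δ)
    (hδ1 : δ ≤ 1) (hT : 0 < T) :
    Real.log ((t : ℝ) ^ 2 * x / δ) ≤ 2 * Real.log (2 * T * x / δ) := by
  have hT' : (1 : ℝ) ≤ T := by exact_mod_cast hT
  rcases Nat.eq_zero_or_pos t with rfl | ht
  · have : 0 ≤ Real.log (2 * T * x / δ) := by
      refine Real.log_nonneg ?_
      rw [le_div_iff₀ hδ]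
      nlinarith
    simpa using this
  · have ht' : (0 : ℝ) < t := by exact_mod_cast ht
    have htT' : (t : ℝ) ≤ T := by exact_mod_cast htT
    have h1 : (2 : ℝ) * Real.log (2 * T * x / δ) = Real.log ((2 * T * x / δ) ^ 2) := by
      rw [Real.log_pow]; norm_num
    rw [h1]
    refine Real.log_le_log (by positivity) ?_
    rw [div_pow, div_le_div_iff₀ hδ (by positivity)]
    have h2 : (t : ℝ) ^ 2 * x ≤ T ^ 2 * x := by gcongr
    have h3 : (T : ℝ) ^ 2 * x ≤ (2 * T * x) ^ 2 := by
      nlinarith [sq_nonneg (T : ℝ), mul_nonneg (sq_nonneg (T : ℝ)) (by linarith : (0 : ℝ) ≤ x - 1),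
        mul_nonneg (mul_nonneg (sq_nonneg (T : ℝ)) (by linarith : (0 : ℝ) ≤ x - 1))
          (by linarith : (0 : ℝ) ≤ x)]
    have h4 : δ ^ 2 ≤ δ := by nlinarith
    calc (t : ℝ) ^ 2 * x * δ ^ 2 ≤ (2 * T * x) ^ 2 * δ ^ 2 := by gcongr; linarith
      _ ≤ (2 * T * x) ^ 2 * δ := by gcongr

/-- The mediant bound `min(B/N, 1) ≤ (B+H)/(N+H)` for the truncated squared uncertainty. -/
theorem min_sigma_sq_le {t : ℕ} (D : Fin t → Traj S A H) {κ δ L : ℝ} (hH : 0 < H)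
    (hL : Real.log ((t : ℝ) ^ 2 * Fintype.card S * Fintype.card A / δ) ≤ L) (hL0 : 0 ≤ L)
    (s : S) (a : A) :
    min (sigma κ δ D s a ^ 2) 1 ≤
      (κ ^ 2 * (Fintype.card S * L) + H) / (visits D s a + H) := by
  have hH' : (0 : ℝ) < H := by exact_mod_cast hH
  have hB : 0 ≤ κ ^ 2 * (Fintype.card S * L) := by positivity
  rw [le_div_iff₀ (by positivity)]
  by_cases hv : visits D s a = 0
  · have h1 : min (sigma κ δ D s a ^ 2) 1 ≤ 1 := min_le_right _ _
    rw [hv]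
    push_cast
    nlinarith
  · have hN : (0 : ℝ) < visits D s a := by exact_mod_cast Nat.pos_of_ne_zero hv
    have h1 : sigma κ δ D s a ^ 2 * visits D s a ≤ κ ^ 2 * (Fintype.card S * L) := by
      rw [sigma, if_neg hv, mul_pow, Real.sq_sqrt', mul_assoc (κ ^ 2)]
      refine mul_le_mul_of_nonneg_left ?_ (sq_nonneg κ)
      rw [max_mul_of_nonneg _ _ hN.le, zero_mul, max_le_iff]
      refine ⟨?_, by positivity⟩
      rw [div_mul_cancel₀ _ hN.ne']
      exact mul_le_mul_of_nonneg_left hL (Nat.cast_nonneg _)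
    have h2 : min (sigma κ δ D s a ^ 2) 1 * visits D s a ≤ κ ^ 2 * (Fintype.card S * L) :=
      (mul_le_mul_of_nonneg_right (min_le_left _ _) hN.le).trans h1
    have h3 : min (sigma κ δ D s a ^ 2) 1 * H ≤ H :=
      mul_le_of_le_one_left hH'.le (min_le_right _ _)
    linarith

/-- The elliptical-potential bound, which holds on every run. -/
theorem sum_min_sigma_sq_le {T : ℕ} (ω : Fin T → Traj S A H) {κ δ : ℝ} (hH : 0 < H) (hT : 0 < T)
    (hS : 0 < Fintype.card S) (hA : 0 < Fintype.card A) (hδ : 0 < δ) (hδ1 : δ ≤ 1) :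
    ∑ t : Fin T, ∑ h : Fin H,
      min ((sigma κ δ (history ω t) ((ω t).1 h.castSucc) ((ω t).2 h)) ^ 2) 1 ≤
    (4 * κ ^ 2 + 4) * ((H : ℝ) * (Fintype.card S : ℝ) ^ 2 * (Fintype.card A : ℝ)) *
      (Real.log (2 * T * Fintype.card S * Fintype.card A / δ) * Real.log (1 + T * H)) := by
  have hH' : (1 : ℝ) ≤ H := by exact_mod_cast hH
  have hT' : (1 : ℝ) ≤ T := by exact_mod_cast hT
  have hS' : (1 : ℝ) ≤ Fintype.card S := by exact_mod_cast hS
  have hA' : (1 : ℝ) ≤ Fintype.card A := by exact_mod_cast hA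
  have hSA : (1 : ℝ) ≤ (Fintype.card S : ℝ) * Fintype.card A := by nlinarith
  set ℓ := Real.log (2 * T * Fintype.card S * Fintype.card A / δ) with hℓ
  have hℓ1 : 1 / 2 ≤ ℓ := by
    have h1 : Real.log 2 ≤ ℓ := by
      refine Real.log_le_log (by norm_num) ?_
      rw [le_div_iff₀ hδ]
      nlinarith [mul_le_mul hT' hSA (by norm_num) (by positivity)]
    linarith [Real.log_two_gt_d9]
  set K : ℝ := κ ^ 2 * (Fintype.card S * (2 * ℓ)) + H with hK
  have hK0 : 0 ≤ K := by positivity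
  have hKle : K ≤ (2 * κ ^ 2 + 2) * (H * Fintype.card S * ℓ) := by
    have h1 : (Fintype.card S : ℝ) * ℓ ≤ H * Fintype.card S * ℓ := by
      rw [mul_assoc]
      exact le_mul_of_one_le_left (by positivity) hH'
    have h2 : (H : ℝ) ≤ 2 * (H * Fintype.card S * ℓ) := by
      have : 1 / 2 ≤ Fintype.card S * ℓ := by nlinarith
      nlinarith
    have h3 : κ ^ 2 * ((Fintype.card S : ℝ) * ℓ) ≤ κ ^ 2 * (H * Fintype.card S * ℓ) :=
      mul_le_mul_of_nonneg_left h1 (sq_nonneg κ)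
    rw [hK]
    linarith
  have hlog : ∀ s a, Real.log (visits ω s a + H) - Real.log H ≤ Real.log (1 + T * H) := by
    intro s a
    rw [← Real.log_div (by positivity) (by positivity)]
    refine Real.log_le_log (by positivity) ?_
    rw [div_le_iff₀ (by positivity)]
    have h1 : (visits ω s a : ℝ) ≤ T * H := by exact_mod_cast visits_le ω s a
    have h2 : (T : ℝ) * H ≤ T * H * H := le_mul_of_one_le_right (by positivity) hH'
    linarith
  have hlog0 : 0 ≤ Real.log (1 + T * H) := Real.log_nonneg (by
    have : (0 : ℝ) ≤ T * H := by positivity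
    linarith)
  calc ∑ t : Fin T, ∑ h : Fin H,
        min ((sigma κ δ (history ω t) ((ω t).1 h.castSucc) ((ω t).2 h)) ^ 2) 1
      ≤ ∑ t : Fin T, ∑ h : Fin H,
          K / (visits (history ω t) ((ω t).1 h.castSucc) ((ω t).2 h) + H) := by
        refine Finset.sum_le_sum fun t _ => Finset.sum_le_sum fun h _ => ?_
        refine min_sigma_sq_le _ hH ?_ (by positivity) _ _
        have := log_le_two_mul_log t.2.le hSA hδ hδ1 hT
        simpa only [mul_assoc, hℓ] using this
    _ = ∑ s, ∑ a, K * ∑ t : Fin T,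
          (trajVisits (ω t) s a : ℝ) / (visits (history ω t) s a + H) := by
        rw [Finset.sum_congr rfl fun t _ => sum_steps_eq_sum_pairs (ω t)
          (fun s a => K / (visits (history ω t) s a + H)), Finset.sum_comm]
        refine Finset.sum_congr rfl fun s _ => ?_
        rw [Finset.sum_comm]
        refine Finset.sum_congr rfl fun a _ => ?_
        rw [Finset.mul_sum]
        exact Finset.sum_congr rfl fun t _ => by ring
    _ ≤ ∑ s : S, ∑ a : A, K * (2 * Real.log (1 + T * H)) := by
        refine Finset.sum_le_sum fun s _ => Finset.sum_le_sum fun a _ => ?_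
        refine mul_le_mul_of_nonneg_left ((sum_trajVisits_div_le hH ω s a).trans ?_) hK0
        linarith [hlog s a]
    _ = K * (2 * Fintype.card S * Fintype.card A * Real.log (1 + T * H)) := by
        simp only [Finset.sum_const, Finset.card_univ, nsmul_eq_mul]
        ring
    _ ≤ (2 * κ ^ 2 + 2) * (H * Fintype.card S * ℓ) *
          (2 * Fintype.card S * Fintype.card A * Real.log (1 + T * H)) :=
        mul_le_mul_of_nonneg_right hKle (by positivity)
    _ = _ := by ring

theorem infoGain_le (M : TabularMDP S A) {Pol : Set (Policy S A)} (hPol : Pol.Nonempty)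
    {κ δ : ℝ} {T : ℕ} (hT : 0 < T) (hδ : 0 < δ) (hδ1 : δ ≤ 1) :
    infoGain M Pol κ δ T ≤
      (4 * κ ^ 2 + 4) * ((M.H : ℝ) * (Fintype.card S : ℝ) ^ 2 * (Fintype.card A : ℝ)) *
        (Real.log (2 * T * Fintype.card S * Fintype.card A / δ) * Real.log (1 + T * M.H)) := by
  obtain ⟨π, hπ⟩ := hPol
  have : Nonempty {alg : Alg S A M.H // ∀ t D, alg t D ∈ Pol} := ⟨⟨fun _ _ => π, fun _ _ => hπ⟩⟩
  refine ciSup_le fun alg => ?_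
  refine le_trans ?_ (runExp_const M alg.1 (T := T) _).le
  exact runExp_mono M alg.1 fun ω =>
    sum_min_sigma_sq_le ω M.H_pos hT (Fintype.card_pos_iff.2 ⟨M.s₀⟩) (card_pos_of_policy M π) hδ hδ1

end Pathwise

/-! ### Concentration of the empirical transitions -/

section SubGaussian

/-- Hoeffding's lemma for a finitely supported distribution. -/
theorem sum_mul_exp_le {ι : Type*} [Fintype ι] {p X : ι → ℝ} {c : ℝ} (hp : ∀ i, 0 ≤ p i)
    (hp1 : ∑ i, p i = 1) (hX0 : ∑ i, p i * X i = 0) (hX : ∀ i, |X i| ≤ c) :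
    ∑ i, p i * Real.exp (X i) ≤ Real.exp (c ^ 2 / 2) := by
  have hchord : ∀ i, Real.exp (X i) ≤ Real.cosh c + X i * (Real.sinh c / c) := by
    intro i
    have hc0 : 0 ≤ c := (abs_nonneg _).trans (hX i)
    obtain ⟨h1, h2⟩ := abs_le.1 (hX i)
    rcases hc0.eq_or_lt with rfl | hc
    · have : X i = 0 := by linarith
      simp [this]
    · have ha : 0 ≤ (c - X i) / (2 * c) := div_nonneg (by linarith) (by positivity)
      have hb : 0 ≤ (c + X i) / (2 * c) := div_nonneg (by linarith) (by positivity)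
      have h3 := convexOn_exp.2 (Set.mem_univ (-c)) (Set.mem_univ c) ha hb
        (by field_simp; ring)
      simp only [smul_eq_mul] at h3
      have h4 : (c - X i) / (2 * c) * -c + (c + X i) / (2 * c) * c = X i := by
        field_simp; ring
      rw [h4] at h3
      refine h3.trans (le_of_eq ?_)
      rw [Real.cosh_eq, Real.sinh_eq]
      field_simp; ring
  calc ∑ i, p i * Real.exp (X i)
      ≤ ∑ i, p i * (Real.cosh c + X i * (Real.sinh c / c)) :=
        Finset.sum_le_sum fun i _ => mul_le_mul_of_nonneg_left (hchord i) (hp i)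
    _ = (∑ i, p i) * Real.cosh c + (∑ i, p i * X i) * (Real.sinh c / c) := by
        simp only [mul_add, Finset.sum_add_distrib, Finset.sum_mul, mul_assoc]
    _ = Real.cosh c := by rw [hp1, hX0]; ring
    _ ≤ Real.exp (c ^ 2 / 2) := Real.cosh_le_exp_half_sq c

end SubGaussian

section Signs

open Classical in
/-- The sign `1` on `U` and `-1` off `U`. -/
noncomputable def signOf {S : Type*} (U : Finset S) (s' : S) : ℝ := if s' ∈ U then 1 else -1

theorem abs_signOf_le {S : Type*} (U : Finset S) (s' : S) : |signOf U s'| ≤ 1 := by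
  unfold signOf; split_ifs <;> simp

variable {S A : Type*} [Fintype S]

/-- The mean of the sign of `U` at the next state. -/
noncomputable def signMean (P : Kern S A) (U : Finset S) (s : S) (a : A) : ℝ :=
  ∑ s', (P s a).1 s' * signOf U s'

open Classical in
/-- The factor that a step contributes to the exponential supermartingale of the pair `(s,a)` and
the sign of `U`: the exponential of the compensated increment at `(s,a)`, and `1` elsewhere. -/
noncomputable def stepWeight (P : Kern S A) (s : S) (a : A) (U : Finset S) (l : ℝ)
    (x : S) (y : A) (s' : S) : ℝ :=
  Real.exp (if x = s ∧ y = a then l * (signOf U s' - signMean P U s a) - 2 * l ^ 2 else 0)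

theorem abs_signMean_le (P : Kern S A) (U : Finset S) (s : S) (a : A) :
    |signMean P U s a| ≤ 1 := by
  rw [← (P s a).2.2]
  refine (Finset.abs_sum_le_sum_abs _ _).trans (Finset.sum_le_sum fun s' _ => ?_)
  rw [abs_mul, abs_of_nonneg ((P s a).2.1 s')]
  exact mul_le_of_le_one_right ((P s a).2.1 s') (abs_signOf_le U s')

theorem sum_stepWeight_le_one (P : Kern S A) (s : S) (a : A) (U : Finset S) (l : ℝ)
    (x : S) (y : A) : ∑ s', (P x y).1 s' * stepWeight P s a U l x y s' ≤ 1 := by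
  by_cases h : x = s ∧ y = a
  · obtain ⟨rfl, rfl⟩ := h
    have h1 := sum_mul_exp_le (p := (P x y).1)
      (X := fun s' => l * (signOf U s' - signMean P U x y)) (c := 2 * |l|) (P x y).2.1 (P x y).2.2
      (by
        have h2 : ∀ s', (P x y).1 s' * (l * (signOf U s' - signMean P U x y)) =
            l * ((P x y).1 s' * signOf U s' - (P x y).1 s' * signMean P U x y) :=
          fun s' => by ring
        simp only [h2, ← Finset.mul_sum, Finset.sum_sub_distrib, ← Finset.sum_mul]
        rw [(P x y).2.2, one_mul]
        simp [signMean])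
      (fun s' => by
        rw [abs_mul, mul_comm]
        refine mul_le_mul_of_nonneg_right ?_ (abs_nonneg l)
        refine (abs_sub _ _).trans ?_
        linarith [abs_signOf_le U s', abs_signMean_le P U x y])
    have h3 : (2 * |l|) ^ 2 / 2 = 2 * l ^ 2 := by rw [mul_pow, sq_abs]; ring
    rw [h3] at h1
    simp only [stepWeight, and_self, if_true, Real.exp_sub, ← mul_div_assoc, ← Finset.sum_div]
    rw [div_le_one (Real.exp_pos _)]
    exact h1
  · simp [stepWeight, h, (P x y).2.2]

/-- The exponential supermartingale in terms of the counts. -/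
theorem prod_stepWeight {H t : ℕ} (P : Kern S A) (D : Fin t → Traj S A H) (s : S) (a : A)
    (U : Finset S) (l : ℝ) :
    ∏ i : Fin t, ∏ h : Fin H,
        stepWeight P s a U l ((D i).1 h.castSucc) ((D i).2 h) ((D i).1 h.succ) =
      Real.exp (l * (∑ s', (transitions D s a s' : ℝ) * signOf U s' -
        visits D s a * signMean P U s a) - 2 * l ^ 2 * visits D s a) := by
  classical
  simp only [stepWeight, ← Real.exp_sum]
  congr 1
  rw [← Fintype.sum_prod_type' (f := fun (i : Fin t) (h : Fin H) =>
    if (D i).1 h.castSucc = s ∧ (D i).2 h = a then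
      l * (signOf U ((D i).1 h.succ) - signMean P U s a) - 2 * l ^ 2 else 0), ← Finset.sum_filter]
  have h1 : ∑ s', (transitions D s a s' : ℝ) * signOf U s' =
      ∑ p : Fin t × Fin H with (D p.1).1 p.2.castSucc = s ∧ (D p.1).2 p.2 = a,
        signOf U ((D p.1).1 p.2.succ) := by
    rw [← Finset.sum_fiberwise_of_maps_to (t := Finset.univ)
      (g := fun p : Fin t × Fin H => (D p.1).1 p.2.succ) (fun _ _ => Finset.mem_univ _)]
    refine Finset.sum_congr rfl fun s' _ => ?_
    rw [Finset.filter_filter, transitions, ← nsmul_eq_mul, ← Finset.sum_const]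
    exact Finset.sum_congr (by congr) fun p hp => by rw [(Finset.mem_filter.1 hp).2.2]
  rw [h1]
  simp only [Finset.sum_sub_distrib, Finset.sum_const, ← Finset.mul_sum, nsmul_eq_mul]
  have h2 : ((Finset.univ.filter fun p : Fin t × Fin H =>
      (D p.1).1 p.2.castSucc = s ∧ (D p.1).2 p.2 = a).card : ℝ) = visits D s a := by
    unfold visits; congr
  rw [h2]
  ring

/-- The `ℓ¹` error is attained at one of the `2^S` signs. -/
theorem exists_sign_kernDist {H t : ℕ} (P P₀ : Kern S A) (D : Fin t → Traj S A H) (s : S) (a : A)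
    (hv : visits D s a ≠ 0) :
    ∃ U : Finset S, ∑ s', (transitions D s a s' : ℝ) * signOf U s' -
        visits D s a * signMean P U s a = visits D s a * kernDist (empirical P₀ D) P s a := by
  classical
  refine ⟨Finset.univ.filter fun s' => (P s a).1 s' ≤ (empirical P₀ D s a).1 s', ?_⟩
  rw [signMean, kernDist, Finset.mul_sum, Finset.mul_sum, ← Finset.sum_sub_distrib]
  refine Finset.sum_congr rfl fun s' _ => ?_
  have hv' : (visits D s a : ℝ) ≠ 0 := by exact_mod_cast hv
  have h1 : (transitions D s a s' : ℝ) = visits D s a * (empirical P₀ D s a).1 s' := by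
    simp only [empirical, hv, dif_neg, not_false_eq_true]
    field_simp
  rw [h1]
  by_cases h : (P s a).1 s' ≤ (empirical P₀ D s a).1 s'
  · rw [abs_of_nonneg (by linarith), signOf, if_pos (by simpa using h)]
    ring
  · rw [abs_of_neg (by linarith), signOf, if_neg (by simpa using h)]
    ring

end Signs

section Concentration

variable {S A : Type*} [Fintype S] [Fintype A]

/-- The confidence sets fail: at some pair the `ℓ¹` error of the empirical kernel exceeds the
truncated uncertainty. -/
def ConfFails {H t : ℕ} (P P₀ : Kern S A) (κ δ : ℝ) (D : Fin t → Traj S A H) : Prop :=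
  ∃ s a, min (sigma κ δ D s a) 2 < kernDist (empirical P₀ D) P s a

open Classical in
/-- The indicator of the failure of the confidence sets. -/
noncomputable def confFailInd {H t : ℕ} (P P₀ : Kern S A) (κ δ : ℝ) (D : Fin t → Traj S A H) : ℝ :=
  if ConfFails P P₀ κ δ D then 1 else 0

/-- Markov's inequality, pathwise: a failure at `(s,a)` with `N_t(s,a) = n` makes the
supermartingale with `λ = σ/4` at least `exp(n σ² / 8)`, where `n σ² = κ² S L`. -/
theorem confFailInd_le {H t : ℕ} (P P₀ : Kern S A) {κ δ : ℝ} (D : Fin t → Traj S A H)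
    {L : ℝ} (hL : L = Real.log ((t : ℝ) ^ 2 * Fintype.card S * Fintype.card A / δ))
    (hL0 : 0 ≤ L) (hκ : 0 ≤ κ) :
    confFailInd P P₀ κ δ D ≤
      ∑ s : S, ∑ a : A, ∑ U : Finset S, ∑ n ∈ Finset.Icc 1 (t * H),
        Real.exp (-(κ ^ 2 * (Fintype.card S * L) / 8)) *
          ∏ i : Fin t, ∏ h : Fin H,
            stepWeight P s a U (κ * √(Fintype.card S * L / n) / 4)
              ((D i).1 h.castSucc) ((D i).2 h) ((D i).1 h.succ) := by
  have hnn : ∀ s a U (n : ℕ), 0 ≤ Real.exp (-(κ ^ 2 * (Fintype.card S * L) / 8)) *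
      ∏ i : Fin t, ∏ h : Fin H, stepWeight P s a U (κ * √(Fintype.card S * L / n) / 4)
        ((D i).1 h.castSucc) ((D i).2 h) ((D i).1 h.succ) := fun s a U n =>
    mul_nonneg (Real.exp_pos _).le (Finset.prod_nonneg fun i _ => Finset.prod_nonneg fun h _ =>
      (Real.exp_pos _).le)
  by_cases hbad : ConfFails P P₀ κ δ D
  swap
  · rw [confFailInd, if_neg hbad]
    exact Finset.sum_nonneg fun s _ => Finset.sum_nonneg fun a _ => Finset.sum_nonneg fun U _ =>
      Finset.sum_nonneg fun n _ => hnn s a U n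
  rw [confFailInd, if_pos hbad]
  obtain ⟨s, a, hsa⟩ := hbad
  have hσ : sigma κ δ D s a < kernDist (empirical P₀ D) P s a := by
    rcases min_lt_iff.1 hsa with h | h
    · exact h
    · exact absurd h (kernDist_le_two _ _ s a).not_gt
  have hv : visits D s a ≠ 0 := by
    intro h
    rw [sigma, if_pos h] at hσ
    exact absurd hσ (kernDist_le_two _ _ s a).not_gt
  obtain ⟨U, hU⟩ := exists_sign_kernDist P P₀ D s a hv
  have hN : (0 : ℝ) < visits D s a := by exact_mod_cast Nat.pos_of_ne_zero hv
  have hmem : visits D s a ∈ Finset.Icc 1 (t * H) :=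
    Finset.mem_Icc.2 ⟨Nat.pos_of_ne_zero hv, visits_le D s a⟩
  have hterm : 1 ≤ Real.exp (-(κ ^ 2 * (Fintype.card S * L) / 8)) *
      ∏ i : Fin t, ∏ h : Fin H, stepWeight P s a U (κ * √(Fintype.card S * L / visits D s a) / 4)
        ((D i).1 h.castSucc) ((D i).2 h) ((D i).1 h.succ) := by
    rw [prod_stepWeight, hU, ← Real.exp_add, ← Real.exp_zero]
    refine Real.exp_le_exp.2 ?_
    rw [sigma, if_neg hv, ← hL] at hσ
    set σ := κ * √(Fintype.card S * L / visits D s a) with hσdef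
    have hσ0 : 0 ≤ σ := by positivity
    have hsq : σ ^ 2 * visits D s a = κ ^ 2 * (Fintype.card S * L) := by
      rw [hσdef, mul_pow, Real.sq_sqrt (by positivity), mul_assoc, div_mul_cancel₀ _ hN.ne']
    rw [← hsq]
    have h1 : σ / 4 * (visits D s a * σ) ≤
        σ / 4 * (visits D s a * kernDist (empirical P₀ D) P s a) := by
      gcongr
    nlinarith
  refine hterm.trans ?_
  refine le_trans ?_ (Finset.single_le_sum (fun s _ => Finset.sum_nonneg fun a _ =>
    Finset.sum_nonneg fun U _ => Finset.sum_nonneg fun n _ => hnn s a U n) (Finset.mem_univ s))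
  refine le_trans ?_ (Finset.single_le_sum (fun a _ =>
    Finset.sum_nonneg fun U _ => Finset.sum_nonneg fun n _ => hnn s a U n) (Finset.mem_univ a))
  refine le_trans ?_ (Finset.single_le_sum (fun U _ =>
    Finset.sum_nonneg fun n _ => hnn s a U n) (Finset.mem_univ U))
  exact Finset.single_le_sum (f := fun n : ℕ =>
    Real.exp (-(κ ^ 2 * (Fintype.card S * L) / 8)) *
      ∏ i : Fin t, ∏ h : Fin H, stepWeight P s a U (κ * √(Fintype.card S * L / n) / 4)
        ((D i).1 h.castSucc) ((D i).2 h) ((D i).1 h.succ)) (fun n _ => hnn s a U n) hmem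

theorem runExp_confFailInd_le_exp (M : TabularMDP S A) (alg : Alg S A M.H) (P₀ : Kern S A)
    {κ δ : ℝ} {t : ℕ} {L : ℝ}
    (hL : L = Real.log ((t : ℝ) ^ 2 * Fintype.card S * Fintype.card A / δ))
    (hL0 : 0 ≤ L) (hκ : 0 ≤ κ) :
    runExp M alg (fun D : Fin t → Traj S A M.H => confFailInd M.P P₀ κ δ D) ≤
      Fintype.card S * Fintype.card A * 2 ^ Fintype.card S * (t * M.H) *
        Real.exp (-(κ ^ 2 * (Fintype.card S * L) / 8)) := by
  refine (runExp_mono M alg fun D => confFailInd_le M.P P₀ D hL hL0 hκ).trans ?_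
  simp only [runExp_sum, runExp_const_mul]
  calc _ ≤ ∑ s : S, ∑ a : A, ∑ U : Finset S, ∑ n ∈ Finset.Icc 1 (t * M.H),
        Real.exp (-(κ ^ 2 * (Fintype.card S * L) / 8)) := by
        refine Finset.sum_le_sum fun s _ => Finset.sum_le_sum fun a _ =>
          Finset.sum_le_sum fun U _ => Finset.sum_le_sum fun n _ => ?_
        exact mul_le_of_le_one_right (Real.exp_pos _).le
          (runExp_prod_le_one M alg _ (fun _ _ _ => (Real.exp_pos _).le)
            (sum_stepWeight_le_one M.P s a U _))
    _ = _ := by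
        simp only [Finset.sum_const, Finset.card_univ, Fintype.card_finset, Nat.card_Icc,
          nsmul_eq_mul]
        push_cast [Nat.add_sub_cancel]
        ring

/-- With `δ = 1/(HT)` and `κ ≥ 4` the confidence sets of iteration `t` fail with probability at
most `1/T`: with `X = t² S A H T`, the union bound costs `S A 2^S t H T ≤ X^(S+1)` and the
exponent gains `X^(2S)`. -/
theorem runExp_confFailInd_le (M : TabularMDP S A) (alg : Alg S A M.H) (P₀ : Kern S A)
    {κ : ℝ} (hκ : 4 ≤ κ) {t T : ℕ} (ht : 0 < t) (htT : t < T)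
    (hS : 0 < Fintype.card S) (hA : 0 < Fintype.card A) :
    runExp M alg (fun D : Fin t → Traj S A M.H =>
      confFailInd M.P P₀ κ (1 / ((M.H : ℝ) * T)) D) ≤ 1 / T := by
  have hH' : (1 : ℝ) ≤ M.H := by exact_mod_cast M.H_pos
  have ht' : (1 : ℝ) ≤ t := by exact_mod_cast ht
  have hT' : (2 : ℝ) ≤ T := by exact_mod_cast (by omega : 2 ≤ T)
  have hS' : (1 : ℝ) ≤ Fintype.card S := by exact_mod_cast hS
  have hA' : (1 : ℝ) ≤ Fintype.card A := by exact_mod_cast hA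
  set X : ℝ := (t : ℝ) ^ 2 * Fintype.card S * Fintype.card A / (1 / ((M.H : ℝ) * T)) with hX
  have hX' : X = t * (Fintype.card S * Fintype.card A * (t * M.H) * T) := by
    rw [hX]; field_simp
  have hY : (2 : ℝ) ≤ Fintype.card S * Fintype.card A * (t * M.H) * T := by
    have h1 : (1 : ℝ) ≤ Fintype.card S * Fintype.card A := one_le_mul_of_one_le_of_one_le hS' hA'
    have h2 : (1 : ℝ) ≤ t * M.H := one_le_mul_of_one_le_of_one_le ht' hH'
    have h3 := one_le_mul_of_one_le_of_one_le h1 h2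
    nlinarith
  have hXY : (Fintype.card S : ℝ) * Fintype.card A * (t * M.H) * T ≤ X := by
    rw [hX']
    exact le_mul_of_one_le_left (by positivity) ht'
  have hX2 : 2 ≤ X := hY.trans hXY
  have hX0 : 0 < X := by linarith
  have hL0 : 0 ≤ Real.log X := Real.log_nonneg (by linarith)
  refine (runExp_confFailInd_le_exp M alg P₀ rfl hL0 (by linarith)).trans ?_
  have hE : Real.exp (-(κ ^ 2 * (Fintype.card S * Real.log X) / 8)) ≤
      (X ^ (2 * Fintype.card S))⁻¹ := by
    rw [← Real.exp_log (pow_pos hX0 (2 * Fintype.card S)), ← Real.exp_neg, Real.log_pow]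
    refine Real.exp_le_exp.2 (neg_le_neg ?_)
    push_cast
    have h1 : 0 ≤ Fintype.card S * Real.log X := by positivity
    have h2 : 16 ≤ κ ^ 2 := by nlinarith
    nlinarith
  rw [le_div_iff₀ (by linarith)]
  calc Fintype.card S * Fintype.card A * 2 ^ Fintype.card S * (t * M.H) *
        Real.exp (-(κ ^ 2 * (Fintype.card S * Real.log X) / 8)) * T
      = (Fintype.card S * Fintype.card A * (t * M.H) * T) * 2 ^ Fintype.card S *
        Real.exp (-(κ ^ 2 * (Fintype.card S * Real.log X) / 8)) := by ring
    _ ≤ X * X ^ Fintype.card S * (X ^ (2 * Fintype.card S))⁻¹ := by gcongr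
    _ ≤ 1 := by
        rw [← div_eq_mul_inv, div_le_one (by positivity), ← pow_succ']
        exact pow_le_pow_right₀ (by linarith) (by omega)

end Concentration

/-! ### Deviations of the expert data -/

section IID

variable {S : Type*} [Fintype S]

theorem sum_prod_mul_prod {p : S → ℝ} {N : ℕ} (g : Fin N → S → ℝ) :
    ∑ E : Fin N → S, (∏ i, p (E i)) * ∏ i, g i (E i) = ∏ i, ∑ s, p s * g i s := by
  classical
  rw [Finset.prod_univ_sum]
  simp only [Fintype.piFinset_univ, Finset.prod_mul_distrib]

theorem sum_prod_mul_apply {p : S → ℝ} (hp1 : ∑ s, p s = 1) {N : ℕ} (f : S → ℝ) (i : Fin N) :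
    ∑ E : Fin N → S, (∏ j, p (E j)) * f (E i) = ∑ s, p s * f s := by
  classical
  have h1 := sum_prod_mul_prod (p := p) (N := N) (fun j s => if j = i then f s else 1)
  rw [Finset.prod_eq_single i (fun j _ hj => by simp [hj, hp1]) (by simp)] at h1
  simpa using h1

/-- Massart's inequality: the largest deviation of a finite class of `[0,1]`-valued functions. -/
theorem sum_prod_mul_iSup_le {p : S → ℝ} (hp : ∀ s, 0 ≤ p s) (hp1 : ∑ s, p s = 1) {N : ℕ}
    (hN : 0 < N) (F : Finset (S → ℝ)) (hF : F.Nonempty)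
    (hF01 : ∀ f ∈ F, ∀ s, f s ∈ Set.Icc (0 : ℝ) 1) :
    ∑ E : Fin N → S, (∏ i, p (E i)) *
        (⨆ f : F, (∑ s, p s * f.1 s - (∑ i, f.1 (E i)) / N)) ≤
      2 * √(Real.log F.card / N) := by
  have hN' : (0 : ℝ) < N := by exact_mod_cast hN
  have : Nonempty F := hF.to_subtype
  set μ : (S → ℝ) → ℝ := fun f => ∑ s, p s * f s with hμ
  set Z : (Fin N → S) → ℝ := fun E => ⨆ f : F, (μ f.1 - (∑ i, f.1 (E i)) / N) with hZ
  have hμ01 : ∀ f ∈ F, μ f ∈ Set.Icc (0 : ℝ) 1 := by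
    intro f hf
    refine ⟨Finset.sum_nonneg fun s _ => mul_nonneg (hp s) (hF01 f hf s).1, ?_⟩
    rw [← hp1]
    exact Finset.sum_le_sum fun s _ => mul_le_of_le_one_right (hp s) (hF01 f hf s).2
  have hpE : ∀ E : Fin N → S, 0 ≤ ∏ i, p (E i) := fun E => Finset.prod_nonneg fun i _ => hp _
  have hpE1 : ∑ E : Fin N → S, ∏ i, p (E i) = 1 := by
    simpa [hp1] using sum_prod_mul_prod (p := p) (N := N) (fun _ _ => 1)
  have hmgf : ∀ l : ℝ, ∀ f ∈ F, ∑ E : Fin N → S, (∏ i, p (E i)) *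
      Real.exp (l * (μ f - (∑ i, f (E i)) / N)) ≤ Real.exp (l ^ 2 / (2 * N)) := by
    intro l f hf
    have h1 : ∀ E : Fin N → S, Real.exp (l * (μ f - (∑ i, f (E i)) / N)) =
        ∏ i, Real.exp (l / N * (μ f - f (E i))) := by
      intro E
      rw [← Real.exp_sum, ← Finset.mul_sum, Finset.sum_sub_distrib]
      congr 1
      simp only [Finset.sum_const, Finset.card_univ, Fintype.card_fin, nsmul_eq_mul]
      field_simp
    simp only [h1]
    rw [sum_prod_mul_prod (fun _ s => Real.exp (l / N * (μ f - f s))), Finset.prod_const,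
      Finset.card_univ, Fintype.card_fin]
    have h2 := sum_mul_exp_le (p := p) (X := fun s => l / N * (μ f - f s)) (c := |l| / N) hp hp1
      (by
        have h3 : ∀ s, p s * (l / N * (μ f - f s)) = l / N * (p s * μ f - p s * f s) :=
          fun s => by ring
        simp only [h3, ← Finset.mul_sum, Finset.sum_sub_distrib, ← Finset.sum_mul]
        rw [hp1, one_mul, sub_self, mul_zero])
      (fun s => by
        rw [abs_mul, abs_div, abs_of_pos hN']
        refine mul_le_of_le_one_right (by positivity) (abs_le.2 ⟨?_, ?_⟩) <;>
        linarith [(hF01 f hf s).1, (hF01 f hf s).2, (hμ01 f hf).1, (hμ01 f hf).2])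
    refine (pow_le_pow_left₀ (Finset.sum_nonneg fun s _ => mul_nonneg (hp s) (Real.exp_pos _).le)
      h2 N).trans (le_of_eq ?_)
    rw [← Real.exp_nat_mul]
    congr 1
    rw [div_pow, sq_abs]
    field_simp
  have hcard : (0 : ℝ) < F.card := by exact_mod_cast hF.card_pos
  -- The tangent line of the logarithm at `a = |F| exp(l²/2N)` replaces Jensen's inequality.
  have hlin : ∀ l : ℝ, 0 < l → l * ∑ E : Fin N → S, (∏ i, p (E i)) * Z E ≤
      Real.log F.card + l ^ 2 / (2 * N) := by
    intro l hl
    set a : ℝ := F.card * Real.exp (l ^ 2 / (2 * N)) with ha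
    have ha0 : 0 < a := by positivity
    have hla : Real.log a = Real.log F.card + l ^ 2 / (2 * N) := by
      rw [ha, Real.log_mul hcard.ne' (Real.exp_pos _).ne', Real.log_exp]
    have hpt : ∀ E : Fin N → S, l * Z E ≤
        (∑ f ∈ F, Real.exp (l * (μ f - (∑ i, f (E i)) / N))) / a - 1 + Real.log a := by
      intro E
      obtain ⟨f, hf⟩ := exists_eq_ciSup_of_finite
        (f := fun f : F => μ f.1 - (∑ i, f.1 (E i)) / N)
      have h1 : Real.exp (l * Z E) ≤ ∑ f ∈ F, Real.exp (l * (μ f - (∑ i, f (E i)) / N)) := by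
        rw [hZ]
        simp only
        rw [← hf]
        exact Finset.single_le_sum
          (f := fun f : S → ℝ => Real.exp (l * (μ f - (∑ i, f (E i)) / N)))
          (fun g _ => (Real.exp_pos _).le) f.2
      have h2 := Real.add_one_le_exp (l * Z E - Real.log a)
      rw [Real.exp_sub, Real.exp_log ha0] at h2
      have h3 := div_le_div_of_nonneg_right h1 ha0.le
      linarith
    have h4 : ∑ E : Fin N → S, (∏ i, p (E i)) *
        ∑ f ∈ F, Real.exp (l * (μ f - (∑ i, f (E i)) / N)) ≤ a := by
      simp only [Finset.mul_sum]
      rw [Finset.sum_comm]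
      refine (Finset.sum_le_sum fun f hf => hmgf l f hf).trans ?_
      simp [ha]
    calc l * ∑ E : Fin N → S, (∏ i, p (E i)) * Z E
        = ∑ E : Fin N → S, (∏ i, p (E i)) * (l * Z E) := by
          rw [Finset.mul_sum]
          exact Finset.sum_congr rfl fun E _ => by ring
      _ ≤ ∑ E : Fin N → S, (∏ i, p (E i)) *
          ((∑ f ∈ F, Real.exp (l * (μ f - (∑ i, f (E i)) / N))) / a - 1 + Real.log a) :=
          Finset.sum_le_sum fun E _ => mul_le_mul_of_nonneg_left (hpt E) (hpE E)
      _ = (∑ E : Fin N → S, (∏ i, p (E i)) *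
          ∑ f ∈ F, Real.exp (l * (μ f - (∑ i, f (E i)) / N))) / a +
          (∑ E : Fin N → S, ∏ i, p (E i)) * (Real.log a - 1) := by
          rw [Finset.sum_div, Finset.sum_mul, ← Finset.sum_add_distrib]
          exact Finset.sum_congr rfl fun E _ => by ring
      _ ≤ 1 + 1 * (Real.log a - 1) := by
          rw [hpE1]
          have := (div_le_one ha0).2 h4
          linarith
      _ = Real.log F.card + l ^ 2 / (2 * N) := by rw [hla]; ring
  set m := ∑ E : Fin N → S, (∏ i, p (E i)) * Z E with hm
  have hlog0 : 0 ≤ Real.log F.card := Real.log_nonneg (by exact_mod_cast hF.card_pos)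
  rcases hlog0.eq_or_lt with h0 | hpos
  · -- A single discriminator: letting `l → 0` shows that the mean deviation is at most zero.
    rw [← h0, zero_div, Real.sqrt_zero, mul_zero]
    refine le_of_forall_pos_le_add fun l hl => ?_
    have h1 := hlin l hl
    rw [← h0, zero_add] at h1
    have h2 : l ^ 2 / (2 * N) ≤ l ^ 2 := by
      refine div_le_self (sq_nonneg l) ?_
      have : (1 : ℝ) ≤ N := by exact_mod_cast hN
      linarith
    nlinarith
  · set r := √(Real.log F.card / N) with hr
    have hr0 : 0 < r := Real.sqrt_pos.2 (by positivity)
    have hr2 : r ^ 2 * N = Real.log F.card := by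
      rw [hr, Real.sq_sqrt (by positivity), div_mul_cancel₀ _ hN'.ne']
    have h1 := hlin (N * r) (by positivity)
    have h2 : (N * r) ^ 2 / (2 * N) = r ^ 2 * N / 2 := by field_simp
    rw [← hr2, h2] at h1
    have h3 : (N * r) * m ≤ (N * r) * (3 / 2 * r) := by nlinarith
    have h4 := le_of_mul_le_mul_left h3 (by positivity)
    linarith

end IID

/-! ### Optimistic imitation -/

section Imitation

variable {S A : Type*} [Fintype S] [Fintype A]

theorem sigma_nonneg {H t : ℕ} {κ : ℝ} (hκ : 0 ≤ κ) (δ : ℝ) (D : Fin t → Traj S A H) (s : S)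
    (a : A) : 0 ≤ sigma κ δ D s a := by
  unfold sigma
  split_ifs
  · norm_num
  · positivity

theorem sq_min_two_le {x : ℝ} (hx : 0 ≤ x) : min x 2 ^ 2 ≤ 4 * min (x ^ 2) 1 := by
  have h0 : 0 ≤ min x 2 := le_min hx (by norm_num)
  rcases le_total x 1 with h | h
  · rw [min_eq_left (by nlinarith : x ^ 2 ≤ 1)]
    nlinarith [min_le_left x 2]
  · rw [min_eq_right (by nlinarith : (1 : ℝ) ≤ x ^ 2)]
    nlinarith [min_le_right x 2]

/-- The statistical error of the expert data: the largest underestimate of a discriminator, plus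
the overestimate of the true cost. -/
noncomputable def expertDev (M : TabularMDP S A) (πe : Policy S A) (F : Finset (S → ℝ)) {N : ℕ}
    (E : Fin N → S) : ℝ :=
  (⨆ f : F, (∑ s, stateOccupancy M.P M.s₀ M.H πe s * f.1 s - (∑ i, f.1 (E i)) / N)) -
    (∑ s, stateOccupancy M.P M.s₀ M.H πe s * M.c s - (∑ i, M.c (E i)) / N)

theorem expertDev_nonneg (M : TabularMDP S A) (πe : Policy S A) {F : Finset (S → ℝ)}
    (hc : M.c ∈ F) {N : ℕ} (E : Fin N → S) : 0 ≤ expertDev M πe F E :=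
  sub_nonneg.2 (le_ciSup (f := fun f : F => ∑ s, stateOccupancy M.P M.s₀ M.H πe s * f.1 s -
    (∑ i, f.1 (E i)) / N) (Set.finite_range _).bddAbove ⟨M.c, hc⟩)

/-- The overestimate of the true cost has mean zero, so that only the supremum contributes. -/
theorem sum_expertProb_mul_expertDev_le (M : TabularMDP S A) (πe : Policy S A)
    {F : Finset (S → ℝ)} (hF : ∀ f ∈ F, ∀ s, f s ∈ Set.Icc (0 : ℝ) 1) (hc : M.c ∈ F) {N : ℕ}
    (hN : 0 < N) :
    ∑ E : Fin N → S, expertProb M πe E * expertDev M πe F E ≤ 2 * √(Real.log F.card / N) := by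
  have hp1 := sum_stateOccupancy M.P M.s₀ M.H_pos πe
  have hN' : (N : ℝ) ≠ 0 := by exact_mod_cast hN.ne'
  have h1 := sum_prod_mul_iSup_le (stateOccupancy_nonneg M.P M.s₀ M.H πe) hp1 hN F ⟨_, hc⟩ hF
  have h2 : ∑ E : Fin N → S, expertProb M πe E *
      (∑ s, stateOccupancy M.P M.s₀ M.H πe s * M.c s - (∑ i, M.c (E i)) / N) = 0 := by
    have h3 : ∑ E : Fin N → S, expertProb M πe E = 1 := by
      simpa [hp1, expertProb] using
        sum_prod_mul_prod (p := stateOccupancy M.P M.s₀ M.H πe) (N := N) (fun _ _ => 1)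
    have h4 : ∑ E : Fin N → S, expertProb M πe E * ∑ i, M.c (E i) =
        N * ∑ s, stateOccupancy M.P M.s₀ M.H πe s * M.c s := by
      simp only [Finset.mul_sum]
      rw [Finset.sum_comm]
      simp only [expertProb, sum_prod_mul_apply hp1]
      simp [Finset.mul_sum]
    simp only [mul_sub, Finset.sum_sub_distrib, ← Finset.sum_mul, h3, ← mul_div_assoc,
      ← Finset.sum_div, h4]
    field_simp
    ring
  simp only [expertDev]
  rw [Finset.sum_congr rfl fun E _ => mul_sub _ _ _, Finset.sum_sub_distrib, h2, sub_zero]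
  exact h1

theorem value_mem_Icc (M : TabularMDP S A) (π : Policy S A) :
    M.value π ∈ Set.Icc (0 : ℝ) M.H := by
  rw [M.value_eq_valueFn]
  refine ⟨valueFn_nonneg _ _ (fun s _ => (M.c_mem s).1) _ _, ?_⟩
  refine (le_abs_self _).trans ((abs_valueFn_le M.P π (k := 1) (fun s _ => ?_) _ _).trans ?_)
  · rw [abs_of_nonneg (M.c_mem s).1]
    exact (M.c_mem s).2
  · rw [mul_one]

/-- While the confidence sets hold, optimism for the expert and the simulation lemma for the
minimizer bound the gap of an iteration by the uncertainty that its own trajectory meets and the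
statistical error. -/
theorem gap_le_of_not_confFails {M : TabularMDP S A} {F : Finset (S → ℝ)} {Pol : Set (Policy S A)}
    {P₀ : Kern S A} {κ δ : ℝ} {N : ℕ} {E : Fin N → S} {alg : Alg S A M.H}
    (halg : IsMobILE M F Pol P₀ κ δ E alg) {πe : Policy S A} (hπe : πe ∈ Pol)
    (hF : ∀ f ∈ F, ∀ s, f s ∈ Set.Icc (0 : ℝ) 1) (hc : M.c ∈ F) {t : ℕ} (ht : 0 < t)
    (D : Fin t → Traj S A M.H) (hD : ¬ ConfFails M.P P₀ κ δ D) :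
    M.value (alg t D) - M.value πe ≤
      valueFn M.P (alg t D) (fun s a => 3 * (M.H : ℝ) ^ 2 * min (sigma κ δ D s a) 2) M.H M.s₀ +
        M.H * expertDev M πe F E := by
  have hH : (0 : ℝ) < M.H := by exact_mod_cast M.H_pos
  set Q := empirical P₀ D with hQ
  set β : S → A → ℝ := fun s a => min (sigma κ δ D s a) 2 with hβ
  have hconf : ∀ s a, kernDist Q M.P s a ≤ β s a := by
    intro s a
    by_contra h
    exact hD ⟨s, a, not_le.1 h⟩
  have hobj : ∀ (π : Policy S A) (f : S → ℝ),
      objective M.s₀ M.H Q (bonus κ δ D) E π f =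
        1 / (M.H : ℝ) * valueFn Q π (fun s a => f s - M.H * β s a) M.H M.s₀ -
          (∑ i, f (E i)) / N := fun π f => by
    rw [objective, sum_occupancy_mul Q M.s₀ M.H π (fun s a => f s - bonus κ δ D s a)]
    rfl
  have hne : Nonempty F := ⟨⟨M.c, hc⟩⟩
  have hmin := halg.isMin t ht D hπe
  simp only [Set.mem_ofPred_eq] at hmin
  have h1 : objective M.s₀ M.H Q (bonus κ δ D) E (alg t D) M.c ≤
      ⨆ f : F, objective M.s₀ M.H Q (bonus κ δ D) E (alg t D) f.1 :=
    le_ciSup (f := fun f : F => objective M.s₀ M.H Q (bonus κ δ D) E (alg t D) f.1)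
      (Set.finite_range _).bddAbove ⟨M.c, hc⟩
  have h2 : (⨆ f : F, objective M.s₀ M.H Q (bonus κ δ D) E πe f.1) ≤
      ⨆ f : F, (∑ s, stateOccupancy M.P M.s₀ M.H πe s * f.1 s - (∑ i, f.1 (E i)) / N) := by
    refine ciSup_mono (Set.finite_range _).bddAbove fun f => ?_
    rw [hobj, sum_stateOccupancy_mul]
    have h3 := valueFn_sub_bonus_le M.P Q πe M.H (hF f.1 f.2) hconf le_rfl M.s₀
    have h4 := mul_le_mul_of_nonneg_left h3 (by positivity : 0 ≤ 1 / (M.H : ℝ))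
    linarith
  have h5 := valueFn_sub_le M.P Q (alg t D) M.H_pos M.c_mem hconf
    (fun s a => min_le_right _ _) le_rfl M.s₀
  have h6 := h1.trans (hmin.trans h2)
  rw [hobj] at h6
  rw [expertDev, sum_stateOccupancy_mul M.P M.s₀ M.H πe M.c, M.value_eq_valueFn,
    M.value_eq_valueFn]
  have h7 := mul_le_mul_of_nonneg_left h6 hH.le
  rw [mul_sub, ← mul_assoc, mul_one_div_cancel hH.ne', one_mul] at h7
  rw [mul_sub, mul_sub, ← mul_assoc, mul_one_div_cancel hH.ne', one_mul]
  linarith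

theorem gap_le {M : TabularMDP S A} {F : Finset (S → ℝ)} {Pol : Set (Policy S A)}
    {P₀ : Kern S A} {κ δ : ℝ} (hκ : 0 ≤ κ) {N : ℕ} {E : Fin N → S} {alg : Alg S A M.H}
    (halg : IsMobILE M F Pol P₀ κ δ E alg) {πe : Policy S A} (hπe : πe ∈ Pol)
    (hF : ∀ f ∈ F, ∀ s, f s ∈ Set.Icc (0 : ℝ) 1) (hc : M.c ∈ F) (t : ℕ)
    (D : Fin t → Traj S A M.H) :
    M.value (alg t D) - M.value πe ≤
      valueFn M.P (alg t D) (fun s a => 3 * (M.H : ℝ) ^ 2 * min (sigma κ δ D s a) 2) M.H M.s₀ +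
        (M.H * expertDev M πe F E + M.H * if t = 0 then 1 else confFailInd M.P P₀ κ δ D) := by
  have hdev := mul_nonneg (Nat.cast_nonneg (α := ℝ) M.H) (expertDev_nonneg M πe hc E)
  have hval := valueFn_nonneg M.P (alg t D)
    (r := fun s a => 3 * (M.H : ℝ) ^ 2 * min (sigma κ δ D s a) 2) (fun s a =>
      mul_nonneg (by positivity) (le_min (sigma_nonneg hκ δ D s a) (by norm_num))) M.H M.s₀
  have h1 := (value_mem_Icc M (alg t D)).2
  have h2 := (value_mem_Icc M πe).1
  split_ifs with ht
  · linarith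
  · by_cases hD : ConfFails M.P P₀ κ δ D
    · rw [confFailInd, if_pos hD]
      linarith
    · rw [confFailInd, if_neg hD]
      linarith [gap_le_of_not_confFails halg hπe hF hc (Nat.pos_of_ne_zero ht) D hD]

/-- Cauchy-Schwarz turns the bound on the squared uncertainties into one on the uncertainties. -/
theorem sum_min_sigma_le {H T : ℕ} (ω : Fin T → Traj S A H) {κ : ℝ} (hκ : 0 ≤ κ) (hH : 0 < H)
    (hT : 0 < T) (hS : 0 < Fintype.card S) (hA : 0 < Fintype.card A) :
    ∑ t : Fin T, ∑ h : Fin H, min (sigma κ (1 / ((H : ℝ) * T)) (history ω t)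
        ((ω t).1 h.castSucc) ((ω t).2 h)) 2 ≤
      √(32 * κ ^ 2 + 32) * Real.log (2 * Fintype.card S * Fintype.card A * H * T) *
        (H * Fintype.card S * √(Fintype.card A) * √T) := by
  have hH' : (1 : ℝ) ≤ H := by exact_mod_cast hH
  have hT' : (1 : ℝ) ≤ T := by exact_mod_cast hT
  have hS' : (1 : ℝ) ≤ Fintype.card S := by exact_mod_cast hS
  have hA' : (1 : ℝ) ≤ Fintype.card A := by exact_mod_cast hA
  have hSA : (1 : ℝ) ≤ Fintype.card S * Fintype.card A := one_le_mul_of_one_le_of_one_le hS' hA'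
  have hHT : (1 : ℝ) ≤ H * T := one_le_mul_of_one_le_of_one_le hH' hT'
  have hY := one_le_mul_of_one_le_of_one_le hSA hHT
  have hδ1 : 1 / ((H : ℝ) * T) ≤ 1 := (div_le_one (by positivity)).2 hHT
  set σ : Fin T × Fin H → ℝ := fun p => sigma κ (1 / ((H : ℝ) * T)) (history ω p.1)
    ((ω p.1).1 p.2.castSucc) ((ω p.1).2 p.2) with hσ
  set ℓ := Real.log (2 * Fintype.card S * Fintype.card A * H * T) with hℓ
  have hℓ0 : 0 ≤ ℓ := Real.log_nonneg (by nlinarith)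
  have hsq := sum_min_sigma_sq_le (κ := κ) ω hH hT hS hA (by positivity) hδ1
  have hlog1 : Real.log (2 * T * Fintype.card S * Fintype.card A / (1 / ((H : ℝ) * T))) ≤
      2 * ℓ := by
    have h1 : 2 * ℓ = Real.log ((2 * Fintype.card S * Fintype.card A * H * T) ^ 2) := by
      rw [Real.log_pow, hℓ]; norm_num
    rw [h1]
    refine Real.log_le_log (by positivity) ?_
    rw [div_div_eq_mul_div, div_one]
    have h2 : (1 : ℝ) ≤ 2 * (Fintype.card S * Fintype.card A * H) := by
      nlinarith [one_le_mul_of_one_le_of_one_le hSA hH']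
    calc (2 : ℝ) * T * Fintype.card S * Fintype.card A * (H * T)
        = 2 * (Fintype.card S * Fintype.card A * H) * T ^ 2 * 1 := by ring
      _ ≤ 2 * (Fintype.card S * Fintype.card A * H) * T ^ 2 *
          (2 * (Fintype.card S * Fintype.card A * H)) := by gcongr
      _ = _ := by ring
  have hlog2 : Real.log (1 + T * H) ≤ ℓ := by
    refine Real.log_le_log (by positivity) ?_
    nlinarith [mul_le_mul_of_nonneg_right hSA (by positivity : (0 : ℝ) ≤ H * T)]
  have hlog3 : 0 ≤ Real.log (1 + T * H) := Real.log_nonneg (by nlinarith)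
  rw [← Fintype.sum_prod_type' (f := fun (t : Fin T) (h : Fin H) =>
    min (sigma κ (1 / ((H : ℝ) * T)) (history ω t) ((ω t).1 h.castSucc) ((ω t).2 h)) 2)]
  rw [← Fintype.sum_prod_type' (f := fun (t : Fin T) (h : Fin H) =>
    min (sigma κ (1 / ((H : ℝ) * T)) (history ω t) ((ω t).1 h.castSucc) ((ω t).2 h) ^ 2) 1)] at hsq
  change ∑ p, min (σ p ^ 2) 1 ≤ _ at hsq
  change ∑ p, min (σ p) 2 ≤ _
  refine abs_le_of_sq_le_sq' ?_ (by positivity) |>.2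
  have hcs := sq_sum_le_card_mul_sum_sq (s := (Finset.univ : Finset (Fin T × Fin H)))
    (f := fun p => min (σ p) 2)
  have hcard : ((Finset.univ : Finset (Fin T × Fin H)).card : ℝ) = T * H := by simp
  rw [hcard] at hcs
  calc (∑ p, min (σ p) 2) ^ 2 ≤ T * H * ∑ p, min (σ p) 2 ^ 2 := hcs
    _ ≤ T * H * ∑ p, 4 * min (σ p ^ 2) 1 := by
        refine mul_le_mul_of_nonneg_left (Finset.sum_le_sum fun p _ => ?_) (by positivity)
        exact sq_min_two_le (sigma_nonneg hκ _ _ _ _)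
    _ ≤ T * H * (4 * ((4 * κ ^ 2 + 4) * ((H : ℝ) * (Fintype.card S : ℝ) ^ 2 *
          (Fintype.card A : ℝ)) * (2 * ℓ * ℓ))) := by
        rw [← Finset.mul_sum]
        gcongr
        refine hsq.trans ?_
        gcongr
    _ = (√(32 * κ ^ 2 + 32) * ℓ * (H * Fintype.card S * √(Fintype.card A) * √T)) ^ 2 := by
        simp only [mul_pow]
        rw [Real.sq_sqrt (by positivity), Real.sq_sqrt (by positivity),
          Real.sq_sqrt (by positivity)]
        ring

/-- The regret bound for fixed expert data. -/
theorem runExp_gap_le {M : TabularMDP S A} {F : Finset (S → ℝ)} {Pol : Set (Policy S A)}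
    {P₀ : Kern S A} {κ : ℝ} (hκ : 4 ≤ κ) {N T : ℕ} (hT : 0 < T) {E : Fin N → S}
    {alg : Alg S A M.H} (halg : IsMobILE M F Pol P₀ κ (1 / ((M.H : ℝ) * T)) E alg)
    {πe : Policy S A} (hπe : πe ∈ Pol) (hF : ∀ f ∈ F, ∀ s, f s ∈ Set.Icc (0 : ℝ) 1)
    (hc : M.c ∈ F) :
    runExp M alg (fun ω : Fin T → Traj S A M.H =>
        (⨅ t : Fin T, M.value (alg t (history ω t))) - M.value πe) ≤
      (3 * √(32 * κ ^ 2 + 32) + 4) *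
        Real.log (2 * Fintype.card S * Fintype.card A * M.H * T) *
          ((M.H : ℝ) ^ 3 * Fintype.card S * √(Fintype.card A) / √T) +
        M.H * expertDev M πe F E := by
  have hS : 0 < Fintype.card S := Fintype.card_pos_iff.2 ⟨M.s₀⟩
  have hA := card_pos_of_policy M πe
  have hH' : (1 : ℝ) ≤ M.H := by exact_mod_cast M.H_pos
  have hT' : (1 : ℝ) ≤ T := by exact_mod_cast hT
  have hS' : (1 : ℝ) ≤ Fintype.card S := by exact_mod_cast hS
  have hA' : (1 : ℝ) ≤ Fintype.card A := by exact_mod_cast hA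
  set δ := 1 / ((M.H : ℝ) * T) with hδ
  set ℓ := Real.log (2 * Fintype.card S * Fintype.card A * M.H * T) with hℓ
  have hℓ1 : 1 / 2 ≤ ℓ := by
    have h1 : Real.log 2 ≤ ℓ := by
      refine Real.log_le_log (by norm_num) ?_
      have := one_le_mul_of_one_le_of_one_le (one_le_mul_of_one_le_of_one_le hS' hA')
        (one_le_mul_of_one_le_of_one_le hH' hT')
      nlinarith
    linarith [Real.log_two_gt_d9]
  set B : (t : ℕ) → (Fin t → Traj S A M.H) → S → A → ℝ := fun t D s a =>
    3 * (M.H : ℝ) ^ 2 * min (sigma κ δ D s a) 2 with hB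
  have hfail : ∀ t : Fin T, runExp M alg (fun D : Fin t → Traj S A M.H =>
      if (t : ℕ) = 0 then 1 else confFailInd M.P P₀ κ δ D) ≤
        (if (t : ℕ) = 0 then 1 else 0) + 1 / T := by
    intro t
    split_ifs with h
    · rw [runExp_const]
      have : (0 : ℝ) ≤ 1 / T := by positivity
      linarith
    · rw [zero_add]
      exact runExp_confFailInd_le M alg P₀ hκ (Nat.pos_of_ne_zero h) t.2 hS hA
  have hiter : ∀ t : Fin T, runExp M alg (fun ω : Fin T → Traj S A M.H =>
      M.value (alg t (history ω t)) - M.value πe) ≤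
      runExp M alg (fun ω : Fin T → Traj S A M.H =>
        ∑ h : Fin M.H, B t (history ω t) ((ω t).1 h.castSucc) ((ω t).2 h)) +
      (M.H * expertDev M πe F E + M.H * ((if (t : ℕ) = 0 then 1 else 0) + 1 / T)) := by
    intro t
    rw [runExp_history M alg t (fun D _ => M.value (alg t D) - M.value πe),
      runExp_history M alg t (fun D τ => ∑ h : Fin M.H, B t D (τ.1 h.castSucc) (τ.2 h))]
    simp only [trajExp_const, trajExp_sum_eq_valueFn]
    refine (runExp_mono M alg fun D => gap_le (by linarith) halg hπe hF hc t D).trans ?_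
    rw [runExp_add, runExp_add, runExp_const, runExp_const_mul]
    have := mul_le_mul_of_nonneg_left (hfail t) (by positivity : (0 : ℝ) ≤ M.H)
    linarith
  have hsum : runExp M alg (fun ω : Fin T → Traj S A M.H =>
      ∑ t : Fin T, ∑ h : Fin M.H, B t (history ω t) ((ω t).1 h.castSucc) ((ω t).2 h)) ≤
      3 * (M.H : ℝ) ^ 2 * (√(32 * κ ^ 2 + 32) * ℓ *
        (M.H * Fintype.card S * √(Fintype.card A) * √T)) := by
    refine (runExp_mono M alg fun ω => ?_).trans (runExp_const M alg (T := T) _).le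
    simp only [hB, ← Finset.mul_sum]
    exact mul_le_mul_of_nonneg_left
      (sum_min_sigma_le ω (by linarith) M.H_pos hT hS hA) (by positivity)
  have htotal : T * runExp M alg (fun ω : Fin T → Traj S A M.H =>
        (⨅ t : Fin T, M.value (alg t (history ω t))) - M.value πe) ≤
      3 * (M.H : ℝ) ^ 2 * (√(32 * κ ^ 2 + 32) * ℓ *
        (M.H * Fintype.card S * √(Fintype.card A) * √T)) +
      (T * (M.H * expertDev M πe F E) + M.H * 2) := by
    rw [← runExp_const_mul]
    calc _ ≤ runExp M alg (fun ω : Fin T → Traj S A M.H =>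
          ∑ t : Fin T, (M.value (alg t (history ω t)) - M.value πe)) := by
          refine runExp_mono M alg fun ω => ?_
          have h1 : ∑ t : Fin T, ((⨅ t : Fin T, M.value (alg t (history ω t))) - M.value πe) ≤
              ∑ t : Fin T, (M.value (alg t (history ω t)) - M.value πe) :=
            Finset.sum_le_sum fun t _ => sub_le_sub_right
              (ciInf_le (f := fun t : Fin T => M.value (alg t (history ω t)))
                (Set.finite_range _).bddBelow t) _
          simpa only [Finset.sum_const, Finset.card_univ, Fintype.card_fin, nsmul_eq_mul] using h1
      _ ≤ ∑ t : Fin T, (runExp M alg (fun ω : Fin T → Traj S A M.H =>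
            ∑ h : Fin M.H, B t (history ω t) ((ω t).1 h.castSucc) ((ω t).2 h)) +
          (M.H * expertDev M πe F E + M.H * ((if (t : ℕ) = 0 then 1 else 0) + 1 / T))) := by
          rw [runExp_sum]
          exact Finset.sum_le_sum fun t _ => hiter t
      _ ≤ _ := by
          rw [Finset.sum_add_distrib, ← runExp_sum]
          refine add_le_add hsum (le_of_eq ?_)
          have h2 : ∑ t : Fin T, (if (t : ℕ) = 0 then (1 : ℝ) else 0) = 1 := by
            obtain ⟨T', rfl⟩ := Nat.exists_eq_succ_of_ne_zero hT.ne'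
            rw [Fin.sum_univ_succ]
            simp
          simp only [mul_add, Finset.sum_add_distrib, ← Finset.mul_sum, h2, Finset.sum_const,
            Finset.card_univ, Fintype.card_fin, nsmul_eq_mul]
          rw [mul_one_div_cancel (by positivity)]
          ring
  have hsT : (1 : ℝ) ≤ √T := Real.one_le_sqrt.2 hT'
  have hsA : (1 : ℝ) ≤ √(Fintype.card A) := Real.one_le_sqrt.2 hA'
  have hTT : √(T : ℝ) * √T = T := Real.mul_self_sqrt (by positivity)
  have hG : (M.H : ℝ) ≤ (M.H : ℝ) ^ 3 * Fintype.card S * √(Fintype.card A) * √T := by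
    calc (M.H : ℝ) = M.H * 1 * 1 * 1 := by ring
      _ ≤ (M.H : ℝ) ^ 3 * Fintype.card S * √(Fintype.card A) * √T := by
        gcongr
        exact le_self_pow₀ hH' (by norm_num)
  have hT0 : (0 : ℝ) < T := by linarith
  refine le_of_mul_le_mul_left (htotal.trans ?_) hT0
  have h3 : (T : ℝ) * ((M.H : ℝ) ^ 3 * Fintype.card S * √(Fintype.card A) / √T) =
      (M.H : ℝ) ^ 3 * Fintype.card S * √(Fintype.card A) * √T := by
    rw [mul_div_assoc', div_eq_iff (by positivity), mul_assoc _ (√(T : ℝ)), hTT]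
    ring
  have h4 : (T : ℝ) * ((3 * √(32 * κ ^ 2 + 32) + 4) * ℓ *
      ((M.H : ℝ) ^ 3 * Fintype.card S * √(Fintype.card A) / √T)) =
      (3 * √(32 * κ ^ 2 + 32) + 4) * ℓ *
        ((M.H : ℝ) ^ 3 * Fintype.card S * √(Fintype.card A) * √T) := by
    rw [← h3]; ring
  rw [mul_add, h4]
  set G := (M.H : ℝ) ^ 3 * Fintype.card S * √(Fintype.card A) * √T with hGdef
  have h5 : 3 * (M.H : ℝ) ^ 2 * (√(32 * κ ^ 2 + 32) * ℓ *
        (M.H * Fintype.card S * √(Fintype.card A) * √T)) = 3 * √(32 * κ ^ 2 + 32) * ℓ * G := by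
    rw [hGdef]; ring
  rw [h5]
  have h6 : (M.H : ℝ) * 2 ≤ 4 * ℓ * G := by nlinarith
  linarith

theorem expectedGap_le {M : TabularMDP S A} {F : Finset (S → ℝ)} {Pol : Set (Policy S A)}
    {P₀ : Kern S A} {κ : ℝ} (hκ : 4 ≤ κ) {N T : ℕ} (hN : 0 < N) (hT : 0 < T)
    {alg : (Fin N → S) → Alg S A M.H}
    (halg : ∀ E, IsMobILE M F Pol P₀ κ (1 / ((M.H : ℝ) * T)) E (alg E))
    {πe : Policy S A} (hπe : πe ∈ Pol) (hF : ∀ f ∈ F, ∀ s, f s ∈ Set.Icc (0 : ℝ) 1)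
    (hc : M.c ∈ F) :
    expectedGap M πe N T alg ≤
      (3 * √(32 * κ ^ 2 + 32) + 4) *
        Real.log (2 * Fintype.card S * Fintype.card A * M.H * T) *
          ((M.H : ℝ) ^ 3 * Fintype.card S * √(Fintype.card A) / √T +
            M.H * √(Real.log F.card / N)) := by
  have hS : 0 < Fintype.card S := Fintype.card_pos_iff.2 ⟨M.s₀⟩
  have hA := card_pos_of_policy M πe
  set ℓ := Real.log (2 * Fintype.card S * Fintype.card A * M.H * T) with hℓ
  have hℓ1 : 1 / 2 ≤ ℓ := by
    have h1 : Real.log 2 ≤ ℓ := by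
      refine Real.log_le_log (by norm_num) ?_
      have h2 : 1 ≤ Fintype.card S * Fintype.card A * M.H * T :=
        Nat.mul_pos (Nat.mul_pos (Nat.mul_pos hS hA) M.H_pos) hT
      have h3 : (1 : ℝ) ≤ Fintype.card S * Fintype.card A * M.H * T := by exact_mod_cast h2
      linarith
    linarith [Real.log_two_gt_d9]
  set R := (3 * √(32 * κ ^ 2 + 32) + 4) * ℓ *
    ((M.H : ℝ) ^ 3 * Fintype.card S * √(Fintype.card A) / √T) with hR
  have hE1 : ∑ E : Fin N → S, expertProb M πe E = 1 := by
    simpa [sum_stateOccupancy M.P M.s₀ M.H_pos πe, expertProb] using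
      sum_prod_mul_prod (p := stateOccupancy M.P M.s₀ M.H πe) (N := N) (fun _ _ => 1)
  have hdev := sum_expertProb_mul_expertDev_le M πe hF hc hN
  have hr : 0 ≤ √(Real.log F.card / N) := Real.sqrt_nonneg _
  calc expectedGap M πe N T alg
      ≤ ∑ E : Fin N → S, expertProb M πe E * (R + M.H * expertDev M πe F E) :=
        Finset.sum_le_sum fun E _ => mul_le_mul_of_nonneg_left
          (runExp_gap_le hκ hT (halg E) hπe hF hc)
          (Finset.prod_nonneg fun i _ => stateOccupancy_nonneg _ _ _ _ _)
    _ = R + M.H * ∑ E : Fin N → S, expertProb M πe E * expertDev M πe F E := by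
        simp only [mul_add, Finset.sum_add_distrib, ← Finset.sum_mul, hE1, one_mul,
          Finset.mul_sum]
        congr 1
        exact Finset.sum_congr rfl fun E _ => by ring
    _ ≤ R + M.H * (2 * √(Real.log F.card / N)) := by gcongr
    _ ≤ R + (3 * √(32 * κ ^ 2 + 32) + 4) * ℓ * (M.H * √(Real.log F.card / N)) := by
        have h1 : 2 ≤ (3 * √(32 * κ ^ 2 + 32) + 4) * ℓ := by
          nlinarith [Real.sqrt_nonneg (32 * κ ^ 2 + 32)]
        have h2 := mul_le_mul_of_nonneg_right h1
          (by positivity : 0 ≤ M.H * √(Real.log F.card / N))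
        linarith
    _ = _ := by rw [hR]; ring

end Imitation

end ILFO

theorem corollary1 :
    (∀ κ : ℝ, 0 < κ → ∃ C : ℝ, 0 < C ∧
      ∀ (S A : Type*) [Fintype S] [Fintype A] (M : ILFO.TabularMDP S A)
        (Pol : Set (ILFO.Policy S A)), Pol.Nonempty →
      ∀ (T : ℕ), 0 < T → ∀ (δ : ℝ), 0 < δ → δ ≤ 1 →
        ILFO.infoGain M Pol κ δ T ≤
          C * ((M.H : ℝ) * (Fintype.card S : ℝ) ^ 2 * (Fintype.card A : ℝ)) *
            (Real.log (2 * T * Fintype.card S * Fintype.card A / δ) *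
              Real.log (1 + T * M.H))) ∧
    (∃ κ₀ : ℝ, 0 < κ₀ ∧ ∀ κ : ℝ, κ₀ ≤ κ → ∃ C : ℝ, 0 < C ∧
      ∀ (S A : Type*) [Fintype S] [Fintype A] (M : ILFO.TabularMDP S A)
        (πe : ILFO.Policy S A) (Pol : Set (ILFO.Policy S A)), πe ∈ Pol →
      ∀ (F : Finset (S → ℝ)), (∀ f ∈ F, ∀ s, f s ∈ Set.Icc (0 : ℝ) 1) → M.c ∈ F →
      ∀ (P₀ : ILFO.Kern S A) (N T : ℕ), 0 < N → 0 < T →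
      ∀ alg : (Fin N → S) → ILFO.Alg S A M.H,
        (∀ E, ILFO.IsMobILE M F Pol P₀ κ (1 / ((M.H : ℝ) * T)) E (alg E)) →
        ILFO.expectedGap M πe N T alg ≤
          C * Real.log (2 * Fintype.card S * Fintype.card A * M.H * T) *
            ((M.H : ℝ) ^ 3 * Fintype.card S * √(Fintype.card A) / √T +
              M.H * √(Real.log F.card / N))) := by
  refine ⟨fun κ _ => ⟨4 * κ ^ 2 + 4, by positivity, ?_⟩,
    4, by norm_num, fun κ hκ => ⟨3 * √(32 * κ ^ 2 + 32) + 4, by positivity, ?_⟩⟩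
  · intro S A _ _ M Pol hPol T hT δ hδ hδ1
    exact ILFO.infoGain_le M hPol hT hδ hδ1
  · intro S A _ _ M πe Pol hπe F hF hc P₀ N T hN hT alg halg
    exact ILFO.expectedGap_le hκ hN hT halg hπe hF hc
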